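/- Let $\mathbb T^3=(\mathbb R/2\pi\mathbb Z)^3$ and, for a real function $u$ on $\mathbb T^3$, let $\widehat u_k=(2\pi)^{-3}\int_{\mathbb T^3}u(x)e^{-ik\cdot x}\,dx$, $k\in\mathbb Z^3$. For $s\ge 0$ let $H^s$ be the space of real $u\in L^2(\mathbb T^3)$ with $$\|u\|_{H^s}^2=|\widehat u_0|^2+\sum_{k\ne0}|k|^{2s}|\widehat u_k|^2<\infty ,$$ and let $\dot H^s=\{u\in H^s:\widehat u_0=0\}$. Write $u_h=u-\widehat u_0$. **Theorem.** Let $0<\varkappa<1$, $m>\frac52$ (real) and $R>0$. There are a constant $\varepsilon>0$ and a function $\eta$ with $\eta(s)\to0$ as $s\to0$, $s\ge 0$, both depending only on $\varkappa,m,R$, such that the following holds. Let $f\in\dot H^{m+1}$ and $g\in\dot H^m$ with $\|f\|_{H^{m+1}}\le R$ and $\|g\|_{H^m}\le R$ (the data need not be small, since $R$ is arbitrary), and let $a\in C([0,\infty);H^m)$ satisfy $$\sup_{t\ge0}\|a(t)\|_{H^m}<\varepsilon .$$ Consider the Cauchy problem $$\partial_t^2u+2\varkappa\,\partial_tu-\Delta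 u=e^{-\varkappa t}a\,(1+u)^3,\qquad u(0)=f,\quad \partial_tu(0)=g, \tag{1}$$ and the projected system, for $u=\widehat u_0+u_h$ and with $\widehat F_0=(2\pi)^{-3}\int_{\mathbb T^3}a(1+u)^3\,dx$, $$\widehat u_0''+2\varkappa\,\widehat u_0'=e^{-\varkappa t}\widehat F_0,\qquad \partial_t^2u_h+2\varkappa\,\partial_tu_h-\Delta u_h=e^{-\varkappa t}\bigl(a(1+u)^3-\widehat F_0\bigr), \tag{2}$$ with the projected initial data. Here a global solution of (1) is a $u\in C([0,\infty);H^{m+1})$ that is twice continuously differentiable in $t\in[0,\infty)$ with values in $L^2(\mathbb T^3)$, satisfies the equation in $L^2(\mathbb T^3)$ for every $t\ge0$, and takes the initial data; a global solution of (2) is a $u\in C([0,\infty);H^{m+1})$ such that $\widehat u_0$ and $u_h$ are twice continuously differentiable in $t$ (with values in $\mathbb R$ and $L^2(\mathbb T^3)$), satisfy (2) for every $t\ge 0$, and take the projected data. Then: 1. $u$ is a global solution of (2) if and only if it is a global solution of (1); 2. there is a unique global solution $u\in C([0,\infty);H^{m+1})$; 3. the limit $\lim_{t\to\infty}\|u(t)\|_{H^{m+1}}$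 exists and is at most $\widetilde\epsilon=\eta\bigl(\sup_{t\ge0}\|a(t)\|_{H^m}\bigr)$. In particular $\widetilde\epsilon$ is as small as desired if $\sup_t\|a(t)\|_{H^m}$ is small enough. -/

import Mathlib

open Real Set Filter Topology MeasureTheory

instance factTwoPiPos : Fact (0 < 2 * π) := ⟨Real.two_pi_pos⟩

/-- The flat torus `𝕋³ = (ℝ / 2πℤ)³`. -/
abbrev Torus3 : Type := Fin 3 → AddCircle (2 * π)

/-- The normalized Lebesgue measure `(2π)⁻³ dx` on `𝕋³`. -/
noncomputable abbrev torusMeasure : Measure Torus3 :=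
  Measure.pi fun _ => (AddCircle.haarAddCircle : Measure (AddCircle (2 * π)))

/-- Real-valued `L²(𝕋³)`. -/
noncomputable abbrev L2Torus : Type := Lp ℝ 2 torusMeasure

/-- The Fourier coefficient `û_k = (2π)⁻³ ∫ u(x) e^{-i k·x} dx`; here
`fourier n y = e^{i n y}` on `ℝ / 2πℤ`. -/
noncomputable def fourierCoeff3 (u : Torus3 → ℝ) (k : Fin 3 → ℤ) : ℂ :=
  ∫ x, (∏ j, fourier (-(k j)) (x j)) * (u x : ℂ) ∂torusMeasure

/-- `|k|²` for `k ∈ ℤ³`. -/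
def freqSq (k : Fin 3 → ℤ) : ℝ := ∑ j, (k j : ℝ) ^ 2

/-- The weight of the frequency `k` in the square of the `Hˢ` norm: `1` for `k = 0`, and
`|k|^{2s}` for `k ≠ 0`. -/
noncomputable def sobolevWeight (s : ℝ) (k : Fin 3 → ℤ) : ℝ :=
  if k = 0 then 1 else freqSq k ^ s

/-- Membership in the Sobolev space `Hˢ(𝕋³)` (for `s ≥ 0`, a subspace of `L²`). -/
def MemSobolev (s : ℝ) (u : L2Torus) : Prop :=
  Summable fun k : Fin 3 → ℤ => sobolevWeight s k * ‖fourierCoeff3 u k‖ ^ 2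

/-- The norm `‖u‖_{Hˢ} = (|û_0|² + ∑_{k ≠ 0} |k|^{2s} |û_k|²)^{1/2}`. -/
noncomputable def sobolevNorm (s : ℝ) (u : L2Torus) : ℝ :=
  √(∑' k : Fin 3 → ℤ, sobolevWeight s k * ‖fourierCoeff3 u k‖ ^ 2)

/-- Membership in the homogeneous space: elements of `Hˢ(𝕋³)` with `û_0 = 0`. -/
def MemHomSobolev (s : ℝ) (u : L2Torus) : Prop :=
  MemSobolev s u ∧ fourierCoeff3 u 0 = 0

/-- `u ∈ C([0,∞); Hˢ)`, with respect to the `Hˢ` norm. Values at negative times are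
irrelevant. -/
def ContSobolev (s : ℝ) (u : ℝ → L2Torus) : Prop :=
  (∀ t, 0 ≤ t → MemSobolev s (u t)) ∧
    ∀ t, 0 ≤ t → Tendsto (fun r => sobolevNorm s (u r - u t)) (𝓝[Ici 0] t) (𝓝 0)

/-- `h = Δu` in the sense of distributions on `𝕋³`: tested against `e^{-i k·x}`, an eigenfunction
of the Laplacian with eigenvalue `-|k|²`. -/
def IsLaplacian (u h : L2Torus) : Prop :=
  ∀ k : Fin 3 → ℤ, fourierCoeff3 h k = -(freqSq k : ℂ) * fourierCoeff3 u k

/-- `v` is the first and `w` the second time derivative of `z` on `[0,∞)` (one-sided at `0`), in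
the norm of the space `E`, and `z` is of class `C²`. -/
structure HasTimeDerivs {E : Type*} [NormedAddCommGroup E] [NormedSpace ℝ E]
    (z v w : ℝ → E) : Prop where
  first : ∀ t, 0 ≤ t → HasDerivWithinAt z (v t) (Ici 0) t
  second : ∀ t, 0 ≤ t → HasDerivWithinAt v (w t) (Ici 0) t
  cont : ContinuousOn w (Ici 0)

/-- `u ∈ C([0,∞); H^{m+1})` is a global solution of the Cauchy problem
`∂ₜ²u + 2κ ∂ₜu - Δu = e^{-κt} a (1 + u)³`, `u(0) = f`, `∂ₜu(0) = g`. The time derivatives are taken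
in `L²(𝕋³)`, and the equation holds in `L²(𝕋³)` at every time `t ≥ 0`. -/
def IsWaveSolution (κ m : ℝ) (a : ℝ → L2Torus) (f g : L2Torus) (u : ℝ → L2Torus) : Prop :=
  ContSobolev (m + 1) u ∧
    ∃ v w : ℝ → L2Torus, HasTimeDerivs u v w ∧ u 0 = f ∧ v 0 = g ∧
      ∀ t, 0 ≤ t → ∃ h : L2Torus, IsLaplacian (u t) h ∧
        ∀ᵐ x ∂torusMeasure,
          w t x + 2 * κ * v t x - h x = exp (-κ * t) * (a t x * (1 + u t x) ^ 3)

/-- The projection `P₀ u = û_0`, that is, the mean value of `u`. -/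
noncomputable def meanPart (u : L2Torus) : ℝ := ∫ x, u x ∂torusMeasure

/-- The complementary projection `u_h = u - û_0`. -/
noncomputable def homPart (u : L2Torus) : L2Torus := u - Lp.const 2 torusMeasure (meanPart u)

/-- `F̂_0 = P₀(a (1 + u)³)`. -/
noncomputable def meanForce (a u : L2Torus) : ℝ :=
  ∫ x, a x * (1 + u x) ^ 3 ∂torusMeasure

/-- `u = û_0 + u_h ∈ C([0,∞); H^{m+1})` is a global solution of the projected system
`û_0'' + 2κ û_0' = e^{-κt} F̂_0`,
`∂ₜ²u_h + 2κ ∂ₜu_h - Δu_h = e^{-κt} (a (1 + u)³ - F̂_0)`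
with the projected initial data of `(f, g)`. -/
def IsProjectedSolution (κ m : ℝ) (a : ℝ → L2Torus) (f g : L2Torus) (u : ℝ → L2Torus) : Prop :=
  ContSobolev (m + 1) u ∧
    (∃ p q : ℝ → ℝ, HasTimeDerivs (fun t => meanPart (u t)) p q ∧
      meanPart (u 0) = meanPart f ∧ p 0 = meanPart g ∧
      ∀ t, 0 ≤ t → q t + 2 * κ * p t = exp (-κ * t) * meanForce (a t) (u t)) ∧
    ∃ v w : ℝ → L2Torus, HasTimeDerivs (fun t => homPart (u t)) v w ∧
      homPart (u 0) = homPart f ∧ v 0 = homPart g ∧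
      ∀ t, 0 ≤ t → ∃ h : L2Torus, IsLaplacian (homPart (u t)) h ∧
        ∀ᵐ x ∂torusMeasure,
          w t x + 2 * κ * v t x - h x =
            exp (-κ * t) * (a t x * (1 + u t x) ^ 3 - meanForce (a t) (u t))

/-! The whole problem is transported to `ℓ²(ℤ³)`: a function of `Hˢ` is replaced by its weighted
Fourier coefficients `⟨k⟩ˢ û_k`, where `⟨k⟩ = |k|` for `k ≠ 0` and `⟨0⟩ = 1`, so that the `Hˢ` norm
becomes the `ℓ²` norm (`sobolevNorm_eq`). Since `s > 3/2` makes `⟨k⟩^{-s}` square summable,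
multiplication in `Hˢ` becomes a bounded bilinear map `B` (`exists_sobolevMul`), and `a (1 + u)³`
becomes a cubic polynomial in the unknown.

Linear part. As `κ < 1 ≤ |k|` for `k ≠ 0`, the roots `λ_± = -κ ± √(κ² - |k|²)` are distinct at every
frequency, and `|λ₊ - λ₋|` is comparable to `⟨k⟩`. The functions `p_± = ∂ₜu - λ_∓ u` satisfy `p_±' =
λ_± p_± + G`, and `u = (p₊ - p₋) / (λ₊ - λ₋)`, so one derivative is gained between the forcing and
`u`. All roots have real part at most `0`, hence the propagators are contractions; the root `0`
occurs only for `λ₊` at `k = 0`, and every other root has real part at most `-κ`.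

Existence and uniqueness. The factor `e^{-κt}` is integrable, so the Duhamel operator is bounded
uniformly in time. On a ball of radius `M` chosen from `R`, the nonlinearity and its Lipschitz
constant are both proportional to `sup ‖a‖`; a small `a` therefore gives a contraction on all of
`[0,∞)` for data of any size (`exists_mild_solution`). Uniqueness without a size restriction is
Grönwall's inequality on compact intervals (`mild_solution_unique`). Strong and mild solutions are
matched frequency by frequency (`IsWaveSolution.eq_linWave`, `isWaveSolution_of_linWave`).

Limit. All parts of the propagators except the zero mode of `λ₊` decay like `e^{-κt}`; against a
forcing of the same decay they contribute `O((1 + t) e^{-κt})`. The remaining zero mode starts from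
`0` because the data have mean zero, and it converges to the integral of its forcing, of size `O(sup
‖a‖)` (`exists_tendsto_linWave`). Thus `u(t)` converges in `H^{m+1}` to a small constant function.

Equivalence of (1) and (2). Taking means and subtracting them splits (1) into (2), because a
Laplacian has mean zero; adding the two equations goes back (`isProjectedSolution_iff`). -/

open scoped ComplexConjugate BoundedContinuousFunction

/-! ### Square-summable sequences and Fourier multipliers -/

/-- The space `ℓ²(ℤ³; ℂ)` of square-summable Fourier coefficients. -/
abbrev SeqSpace : Type := lp (fun _ : Fin 3 → ℤ => ℂ) 2

theorem SeqSpace.ext {x y : SeqSpace} (h : ∀ k, x k = y k) : x = y :=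
  lp.ext (funext h)

theorem SeqSpace.hasSum_norm_sq (x : SeqSpace) : HasSum (fun k => ‖x k‖ ^ 2) (‖x‖ ^ 2) := by
  have := lp.hasSum_norm (p := 2) (by norm_num) x
  simpa using this

theorem memℓp_two_iff {ι : Type*} {c : ι → ℂ} :
    Memℓp c 2 ↔ Summable fun k => ‖c k‖ ^ 2 := by
  have := memℓp_gen_iff (p := 2) (by norm_num) (f := c)
  simpa using this

theorem SeqSpace.norm_le_of_bound {x y : SeqSpace} {K : ℝ} (hK : 0 ≤ K)
    (h : ∀ k, ‖x k‖ ≤ K * ‖y k‖) : ‖x‖ ≤ K * ‖y‖ := by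
  have h1 : ‖x‖ ≤ ‖(K : ℂ) • y‖ :=
    lp.norm_mono (by norm_num) fun k => by
      rw [lp.coeFn_smul, Pi.smul_apply, norm_smul, Complex.norm_real, Real.norm_of_nonneg hK]
      exact h k
  rwa [norm_smul, Complex.norm_real, Real.norm_of_nonneg hK] at h1

/-- Evaluation of a coefficient, as a real-linear functional. -/
noncomputable def coordL (k : Fin 3 → ℤ) : SeqSpace →L[ℝ] ℂ :=
  (lp.evalCLM ℂ (fun _ : Fin 3 → ℤ => ℂ) 2 k).restrictScalars ℝ

open Classical in
/-- The Fourier multiplier with symbol `c` (zero if `c` is unbounded). -/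
noncomputable def diag (c : (Fin 3 → ℤ) → ℂ) : SeqSpace →L[ℂ] SeqSpace :=
  if h : ∃ K : ℝ, 0 ≤ K ∧ ∀ k, ‖c k • ContinuousLinearMap.id ℂ ℂ‖ ≤ K then
    lp.mapCLM 2 (fun k => c k • ContinuousLinearMap.id ℂ ℂ) h.choose_spec.1 h.choose_spec.2
  else 0

theorem diag_apply {c : (Fin 3 → ℤ) → ℂ} {K : ℝ} (hc : ∀ k, ‖c k‖ ≤ K) (x : SeqSpace)
    (k : Fin 3 → ℤ) : diag c x k = c k * x k := by
  have h : ∃ K : ℝ, 0 ≤ K ∧ ∀ k, ‖c k • ContinuousLinearMap.id ℂ ℂ‖ ≤ K :=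
    ⟨K, (norm_nonneg _).trans (hc 0), fun k => by simpa [norm_smul] using hc k⟩
  rw [diag, dif_pos h]
  simp

theorem norm_diag_apply_le {c : (Fin 3 → ℤ) → ℂ} {K : ℝ} (hc : ∀ k, ‖c k‖ ≤ K) (x : SeqSpace) :
    ‖diag c x‖ ≤ K * ‖x‖ := by
  refine SeqSpace.norm_le_of_bound ((norm_nonneg _).trans (hc 0)) fun k => ?_
  rw [diag_apply hc, norm_mul]
  gcongr
  exact hc k

/-- A bounded family of multipliers with continuous symbols is strongly continuous. -/
theorem continuous_diag_const {c : ℝ → (Fin 3 → ℤ) → ℂ} {K : ℝ} (hc : ∀ t k, ‖c t k‖ ≤ K)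
    (hcont : ∀ k, Continuous fun t => c t k) (x : SeqSpace) :
    Continuous fun t => diag (c t) x := by
  rw [continuous_iff_continuousAt]
  intro t
  have hK : 0 ≤ K := (norm_nonneg _).trans (hc t 0)
  rw [ContinuousAt, tendsto_iff_norm_sub_tendsto_zero]
  -- The symbols are not continuous uniformly in `k`, so only strong continuity is available; it
  -- follows by dominated convergence in the squared norm.
  have key : Tendsto (fun s => ∑' k, ‖(diag (c s) x - diag (c t) x) k‖ ^ 2) (𝓝 t)
      (𝓝 (∑' _k : Fin 3 → ℤ, (0 : ℝ))) := by
    refine tendsto_tsum_of_dominated_convergence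
      (bound := fun k => (2 * K) ^ 2 * ‖x k‖ ^ 2) ?_ ?_ ?_
    · exact (SeqSpace.hasSum_norm_sq x).summable.mul_left _
    · intro k
      have : Tendsto (fun s => ‖c s k * x k - c t k * x k‖ ^ 2) (𝓝 t)
          (𝓝 (‖c t k * x k - c t k * x k‖ ^ 2)) :=
        Continuous.tendsto (by have := hcont k; fun_prop) t
      simpa [diag_apply (hc _)] using this
    · refine Eventually.of_forall fun s k => ?_
      have : ‖c s k * x k - c t k * x k‖ ≤ 2 * K * ‖x k‖ := by
        rw [← sub_mul, norm_mul]
        gcongr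
        calc _ ≤ ‖c s k‖ + ‖c t k‖ := norm_sub_le _ _
          _ ≤ 2 * K := by linarith [hc s k, hc t k]
      simp only [lp.coeFn_sub, Pi.sub_apply, diag_apply (hc _), norm_pow, norm_norm]
      calc _ ≤ (2 * K * ‖x k‖) ^ 2 := by gcongr
        _ = _ := by ring
  simp only [tsum_zero] at key
  have h2 := key.sqrt
  simp only [Real.sqrt_zero] at h2
  refine h2.congr fun s => ?_
  rw [(SeqSpace.hasSum_norm_sq _).tsum_eq, Real.sqrt_sq (norm_nonneg _)]

/-- Strong continuity together with the uniform operator bound `K` gives joint continuity. -/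
theorem continuous_diag_uncurry {c : ℝ → (Fin 3 → ℤ) → ℂ} {K : ℝ} (hc : ∀ t k, ‖c t k‖ ≤ K)
    (hcont : ∀ k, Continuous fun t => c t k) :
    Continuous fun p : ℝ × SeqSpace => diag (c p.1) p.2 := by
  rw [continuous_iff_continuousAt]
  rintro ⟨t, x⟩
  rw [ContinuousAt, tendsto_iff_norm_sub_tendsto_zero]
  have h1 : Tendsto (fun p : ℝ × SeqSpace => K * ‖p.2 - x‖ + ‖diag (c p.1) x - diag (c t) x‖)
      (𝓝 (t, x)) (𝓝 (K * ‖x - x‖ + ‖diag (c t) x - diag (c t) x‖)) := by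
    apply Continuous.tendsto (f := fun p : ℝ × SeqSpace =>
      K * ‖p.2 - x‖ + ‖diag (c p.1) x - diag (c t) x‖) (x := (t, x))
    have := (continuous_diag_const hc hcont x).comp (continuous_fst (Y := SeqSpace))
    simp only [Function.comp_def] at this
    fun_prop
  simp only [sub_self, norm_zero, mul_zero, add_zero] at h1
  refine squeeze_zero (fun _ => norm_nonneg _) (fun p => ?_) h1
  calc ‖diag (c p.1) p.2 - diag (c t) x‖
      = ‖diag (c p.1) (p.2 - x) + (diag (c p.1) x - diag (c t) x)‖ := by
        rw [map_sub]; congr 1; abel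
    _ ≤ _ := (norm_add_le _ _).trans (by gcongr; exact norm_diag_apply_le (hc _) _)

/-- A curve with continuous coefficientwise derivative is differentiable in norm. -/
theorem SeqSpace.hasDerivWithinAt_of_coord {z v : ℝ → SeqSpace} (hv : Continuous v)
    (h : ∀ k t, 0 ≤ t → HasDerivWithinAt (fun s => z s k) (v t k) (Ici 0) t) {t : ℝ}
    (ht : 0 ≤ t) : HasDerivWithinAt z (v t) (Ici 0) t := by
  -- The fundamental theorem of calculus holds in each coordinate and evaluation commutes with the
  -- integral; norm differentiability is then that of an integral with continuous integrand.
  have hz : ∀ s ∈ Ici (0 : ℝ), z s = z 0 + ∫ r in (0 : ℝ)..s, v r := by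
    intro s hs
    refine SeqSpace.ext fun k => ?_
    have h1 : (∫ r in (0 : ℝ)..s, v r) k = ∫ r in (0 : ℝ)..s, v r k :=
      ((coordL k).intervalIntegral_comp_comm (hv.intervalIntegrable 0 s)).symm
    have hvk : Continuous fun r => v r k := (coordL k).continuous.comp hv
    have h2 : ∫ r in (0 : ℝ)..s, v r k = z s k - z 0 k := by
      refine intervalIntegral.integral_eq_sub_of_hasDeriv_right (f := fun r => z r k) ?_ ?_
        (hvk.intervalIntegrable 0 s)
      · intro r hr
        rw [uIcc_of_le hs] at hr
        refine (h k r hr.1).continuousWithinAt.mono ?_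
        rw [uIcc_of_le hs]
        exact Icc_subset_Ici_self
      · intro r hr
        rw [min_eq_left hs] at hr
        exact (h k r hr.1.le).mono (Ioi_subset_Ici hr.1.le)
    rw [lp.coeFn_add, Pi.add_apply, h1, h2]
    ring
  have h3 : HasDerivAt (fun s => z 0 + ∫ r in (0 : ℝ)..s, v r) (v t) t :=
    ((hv.integral_hasStrictDerivAt 0 t).hasDerivAt).const_add _
  exact h3.hasDerivWithinAt.congr hz (hz t ht)

/-! ### Characters and the Fourier basis of the torus -/

/-- The character `x ↦ e^{i k·x}` of the torus. -/
noncomputable def torusChar (k : Fin 3 → ℤ) : C(Torus3, ℂ) where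
  toFun x := ∏ j, fourier (k j) (x j)
  continuous_toFun := by fun_prop

theorem torusChar_apply (k : Fin 3 → ℤ) (x : Torus3) :
    torusChar k x = ∏ j, fourier (k j) (x j) := rfl

theorem torusChar_neg (k : Fin 3 → ℤ) (x : Torus3) :
    torusChar (-k) x = conj (torusChar k x) := by
  simp only [torusChar_apply, Pi.neg_apply, fourier_neg, map_prod]

theorem torusChar_add (k l : Fin 3 → ℤ) (x : Torus3) :
    torusChar (k + l) x = torusChar k x * torusChar l x := by
  simp only [torusChar_apply, Pi.add_apply, fourier_add, ← Finset.prod_mul_distrib]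

theorem torusChar_zero (x : Torus3) : torusChar 0 x = 1 := by
  simp [torusChar_apply]

theorem norm_torusChar_apply (k : Fin 3 → ℤ) (x : Torus3) : ‖torusChar k x‖ = 1 := by
  rw [torusChar_apply, norm_prod]
  exact Finset.prod_eq_one fun j _ => Circle.norm_coe _

/-- The star subalgebra of `C(𝕋³, ℂ)` generated by the characters. -/
noncomputable def torusCharSubalgebra : StarSubalgebra ℂ C(Torus3, ℂ) where
  toSubalgebra := Algebra.adjoin ℂ (range torusChar)
  star_mem' := by
    change Algebra.adjoin ℂ (range torusChar) ≤ star (Algebra.adjoin ℂ (range torusChar))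
    refine Algebra.adjoin_le ?_
    rintro _ ⟨n, rfl⟩
    refine Algebra.subset_adjoin ⟨-n, ?_⟩
    ext1 x
    simp only [torusChar_neg, starRingEnd_apply, ContinuousMap.star_apply]

/-- A product of characters is a character, so the linear span is already an algebra. -/
theorem torusCharSubalgebra_coe :
    (torusCharSubalgebra).toSubalgebra.toSubmodule = Submodule.span ℂ (range torusChar) := by
  apply Algebra.adjoin_eq_span_of_subset
  refine .trans (fun x => Submonoid.closure_induction (fun _ => id) ⟨0, ?_⟩ ?_)
    Submodule.subset_span
  · ext z
    simp [torusChar_zero]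
  · rintro _ _ _ _ ⟨m, rfl⟩ ⟨n, rfl⟩
    refine ⟨m + n, ?_⟩
    ext z
    simp [torusChar_add]

/-- Two distinct points differ in some coordinate `i`, and `e^{i x_i}` is injective in that
coordinate. -/
theorem torusCharSubalgebra_separatesPoints : (torusCharSubalgebra).SeparatesPoints := by
  intro x y hxy
  rw [Ne, funext_iff, not_forall] at hxy
  obtain ⟨i, hi⟩ := hxy
  refine ⟨_, ⟨torusChar (Pi.single i 1), Algebra.subset_adjoin ⟨Pi.single i 1, rfl⟩, rfl⟩, ?_⟩
  have h : ∀ z : Torus3, torusChar (Pi.single i 1) z = fourier 1 (z i) := fun z => by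
    rw [torusChar_apply, Finset.prod_eq_single i]
    · simp
    · intro j _ hj
      simp [Pi.single_eq_of_ne hj]
    · simp
  dsimp only
  rw [h, h, fourier_one, fourier_one]
  exact fun hc => hi (AddCircle.injective_toCircle Real.two_pi_pos.ne' (Circle.ext hc))

/-- Stone–Weierstrass; density of continuous functions in `L²` then yields completeness of the
characters. -/
theorem span_torusChar_closure_eq_top :
    (Submodule.span ℂ (range torusChar)).topologicalClosure = ⊤ := by
  rw [← torusCharSubalgebra_coe]
  exact congr_arg (Subalgebra.toSubmodule <| StarSubalgebra.toSubalgebra ·)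
    (ContinuousMap.starSubalgebra_topologicalClosure_eq_top_of_separatesPoints _
      torusCharSubalgebra_separatesPoints)

/-- The characters as elements of `L²(𝕋³; ℂ)`. -/
noncomputable def torusCharLp (k : Fin 3 → ℤ) : Lp ℂ 2 torusMeasure :=
  ContinuousMap.toLp (E := ℂ) 2 torusMeasure ℂ (torusChar k)

theorem coeFn_torusCharLp (k : Fin 3 → ℤ) : torusCharLp k =ᵐ[torusMeasure] torusChar k :=
  ContinuousMap.coeFn_toLp torusMeasure (torusChar k)

theorem span_torusCharLp_closure_eq_top :
    (Submodule.span ℂ (range torusCharLp)).topologicalClosure = ⊤ := by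
  have := (ContinuousMap.toLp_denseRange ℂ torusMeasure ℂ
      (p := 2) (by norm_num)).topologicalClosure_map_submodule span_torusChar_closure_eq_top
  rw [Submodule.map_span, ContinuousLinearMap.coe_coe, ← range_comp] at this
  exact this

theorem integral_torusChar (k : Fin 3 → ℤ) :
    ∫ x, torusChar k x ∂torusMeasure = if k = 0 then 1 else 0 := by
  simp only [torusChar_apply]
  rw [MeasureTheory.integral_fintype_prod_eq_prod
    (f := fun (j : Fin 3) (y : AddCircle (2 * π)) => (fourier (k j) y : ℂ))]
  have h : ∀ n : ℤ, ∫ y : AddCircle (2 * π), (fourier n y : ℂ) ∂AddCircle.haarAddCircle =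
      if n = 0 then 1 else 0 := by
    intro n
    have := orthonormal_iff_ite.mp (orthonormal_fourier (T := 2 * π)) 0 n
    simp only [ContinuousMap.inner_toLp, ← fourier_neg, ← fourier_add] at this
    simpa [eq_comm] using this
  simp only [h]
  split_ifs with hk
  · simp [hk]
  · obtain ⟨i, hi⟩ := Function.ne_iff.mp hk
    exact Finset.prod_eq_zero (Finset.mem_univ i) (if_neg hi)

theorem orthonormal_torusCharLp : Orthonormal ℂ torusCharLp := by
  rw [orthonormal_iff_ite]
  intro m n
  simp only [torusCharLp, ContinuousMap.inner_toLp, ← torusChar_neg, ← torusChar_add]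
  rw [integral_torusChar]
  congr 1
  rw [eq_iff_iff, add_neg_eq_zero, eq_comm]

/-- The Fourier basis of `L²(𝕋³; ℂ)`. -/
noncomputable def torusBasis : HilbertBasis (Fin 3 → ℤ) ℂ (Lp ℂ 2 torusMeasure) :=
  HilbertBasis.mk orthonormal_torusCharLp span_torusCharLp_closure_eq_top.ge

theorem torusBasis_repr (F : Lp ℂ 2 torusMeasure) (k : Fin 3 → ℤ) :
    torusBasis.repr F k = ∫ x, torusChar (-k) x * F x ∂torusMeasure := by
  trans ∫ x, conj (torusCharLp k x) * F x ∂torusMeasure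
  · rw [torusBasis.repr_apply_apply F k, MeasureTheory.L2.inner_def, torusBasis,
      HilbertBasis.coe_mk]
    simp only [RCLike.inner_apply, mul_comm]
  · apply integral_congr_ae
    filter_upwards [coeFn_torusCharLp k] with x hx
    rw [hx, ← torusChar_neg]

/-! ### Real functions and their Fourier coefficients -/

/-- Complexification `L²(𝕋³; ℝ) → L²(𝕋³; ℂ)`. -/
noncomputable def complexify : L2Torus →L[ℝ] Lp ℂ 2 torusMeasure :=
  Complex.ofRealCLM.compLpL 2 torusMeasure

/-- Real part `L²(𝕋³; ℂ) → L²(𝕋³; ℝ)`. -/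
noncomputable def rePart : Lp ℂ 2 torusMeasure →L[ℝ] L2Torus :=
  Complex.reCLM.compLpL 2 torusMeasure

theorem coeFn_complexify (u : L2Torus) :
    complexify u =ᵐ[torusMeasure] fun x => (u x : ℂ) :=
  Complex.ofRealCLM.coeFn_compLpL u

theorem coeFn_rePart (F : Lp ℂ 2 torusMeasure) :
    rePart F =ᵐ[torusMeasure] fun x => (F x).re :=
  Complex.reCLM.coeFn_compLpL F

/-- The sequence of Fourier coefficients of a real function. -/
noncomputable def coeffs : L2Torus →L[ℝ] SeqSpace :=
  (torusBasis.repr.toContinuousLinearEquiv.toContinuousLinearMap.restrictScalars ℝ).comp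
    complexify

theorem coeffs_apply (u : L2Torus) (k : Fin 3 → ℤ) : coeffs u k = fourierCoeff3 u k := by
  change torusBasis.repr (complexify u) k = _
  rw [torusBasis_repr, fourierCoeff3]
  refine integral_congr_ae ?_
  filter_upwards [coeFn_complexify u] with x hx
  rw [hx, torusChar_apply]
  rfl

/-- The real part of the Fourier series with given coefficients. -/
noncomputable def synth : SeqSpace →L[ℝ] L2Torus :=
  rePart.comp
    (torusBasis.repr.symm.toContinuousLinearEquiv.toContinuousLinearMap.restrictScalars ℝ)

theorem synth_coeffs (u : L2Torus) : synth (coeffs u) = u := by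
  change rePart (torusBasis.repr.symm (torusBasis.repr (complexify u))) = u
  rw [LinearIsometryEquiv.symm_apply_apply]
  refine Lp.ext ?_
  filter_upwards [coeFn_rePart (complexify u), coeFn_complexify u] with x h1 h2
  rw [h1, h2, Complex.ofReal_re]

theorem coeffs_injective : Function.Injective coeffs :=
  Function.LeftInverse.injective synth_coeffs

theorem integrable_torusChar_mul (F : Lp ℂ 2 torusMeasure) (k : Fin 3 → ℤ) :
    Integrable (fun x => torusChar k x * F x) torusMeasure := by
  have hF : Integrable F torusMeasure := (Lp.memLp F).integrable (by norm_num)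
  refine hF.bdd_mul (c := 1) (torusChar k).continuous.aestronglyMeasurable ?_
  exact Eventually.of_forall fun x => (norm_torusChar_apply k x).le

/-- Taking the real part of a function symmetrizes its coefficients. Hence `coeffs ∘ synth` is the
projection onto Hermitian sequences, the coefficients of real functions. -/
theorem coeffs_synth (x : SeqSpace) (k : Fin 3 → ℤ) :
    coeffs (synth x) k = (x k + conj (x (-k))) / 2 := by
  set F := torusBasis.repr.symm x with hF
  have hx : ∀ k, x k = ∫ y, torusChar (-k) y * F y ∂torusMeasure := fun k => by
    rw [← torusBasis_repr, hF, LinearIsometryEquiv.apply_symm_apply]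
  have h1 : coeffs (synth x) k = ∫ y, torusChar (-k) y * ((F y).re : ℂ) ∂torusMeasure := by
    change torusBasis.repr (complexify (rePart F)) k = _
    rw [torusBasis_repr]
    refine integral_congr_ae ?_
    filter_upwards [coeFn_complexify (rePart F), coeFn_rePart F] with y h1 h2
    rw [h1, h2]
  have h2 : ∀ y, torusChar (-k) y * ((F y).re : ℂ) =
      (torusChar (-k) y * F y + conj (torusChar k y * F y)) / 2 := fun y => by
    rw [Complex.re_eq_add_conj, map_mul, torusChar_neg]
    ring
  rw [h1, hx k, hx (-k), neg_neg, ← integral_conj, ← integral_add, ← integral_div]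
  · exact integral_congr_ae (Eventually.of_forall h2)
  · exact integrable_torusChar_mul F _
  · exact (LinearIsometryEquiv.integrable_comp_iff (RCLike.conjLIE (K := ℂ))).mpr
      (integrable_torusChar_mul F k)

theorem norm_coeffs_synth_le (x : SeqSpace) : ‖coeffs (synth x)‖ ≤ ‖x‖ := by
  change ‖torusBasis.repr (complexify (rePart (torusBasis.repr.symm x)))‖ ≤ _
  rw [LinearIsometryEquiv.norm_map]
  calc _ ≤ ‖Complex.ofRealCLM‖ * ‖rePart (torusBasis.repr.symm x)‖ :=
        Complex.ofRealCLM.norm_compLp_le _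
    _ ≤ ‖Complex.ofRealCLM‖ * (‖Complex.reCLM‖ * ‖torusBasis.repr.symm x‖) := by
        gcongr
        exact Complex.reCLM.norm_compLp_le _
    _ = ‖x‖ := by simp

/-! ### Frequencies, weights and lattice sums -/

/-- The frequency `k`, as a vector of Euclidean space. -/
noncomputable def freqVec (k : Fin 3 → ℤ) : EuclideanSpace ℝ (Fin 3) :=
  WithLp.toLp 2 fun j => (k j : ℝ)

theorem norm_freqVec_sq (k : Fin 3 → ℤ) : ‖freqVec k‖ ^ 2 = freqSq k := by
  simp [EuclideanSpace.norm_sq_eq, freqVec, freqSq]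

theorem freqVec_add (k l : Fin 3 → ℤ) : freqVec (k + l) = freqVec k + freqVec l := by
  ext j
  simp [freqVec]

theorem freqSq_neg (k : Fin 3 → ℤ) : freqSq (-k) = freqSq k := by
  simp [freqSq]

theorem freqSq_zero : freqSq 0 = 0 := by
  simp [freqSq]

theorem one_le_freqSq {k : Fin 3 → ℤ} (hk : k ≠ 0) : 1 ≤ freqSq k := by
  obtain ⟨i, hi⟩ := Function.ne_iff.mp hk
  have h1 : (1 : ℝ) ≤ (k i : ℝ) ^ 2 := by
    have : (1 : ℤ) ≤ (k i) ^ 2 := by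
      have := pow_pos (abs_pos.mpr hi) 2
      rw [sq_abs] at this
      exact this
    exact_mod_cast this
  exact h1.trans (Finset.single_le_sum (f := fun j => (k j : ℝ) ^ 2)
    (fun j _ => sq_nonneg _) (Finset.mem_univ i))

/-- The modulus `|k|` of a frequency, set to `1` at `k = 0`. -/
noncomputable def bracket (k : Fin 3 → ℤ) : ℝ := if k = 0 then 1 else ‖freqVec k‖

theorem one_le_bracket (k : Fin 3 → ℤ) : 1 ≤ bracket k := by
  rw [bracket]
  split_ifs with hk
  · rfl
  · have := one_le_freqSq hk
    rw [← norm_freqVec_sq] at this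
    nlinarith [norm_nonneg (freqVec k)]

theorem bracket_pos (k : Fin 3 → ℤ) : 0 < bracket k := zero_lt_one.trans_le (one_le_bracket k)

theorem bracket_zero : bracket 0 = 1 := if_pos rfl

theorem bracket_sq {k : Fin 3 → ℤ} (hk : k ≠ 0) : bracket k ^ 2 = freqSq k := by
  rw [bracket, if_neg hk, norm_freqVec_sq]

theorem bracket_neg (k : Fin 3 → ℤ) : bracket (-k) = bracket k := by
  by_cases hk : k = 0
  · simp [hk]
  · have h : bracket (-k) ^ 2 = bracket k ^ 2 := by
      rw [bracket_sq hk, bracket_sq (neg_ne_zero.mpr hk), freqSq_neg]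
    exact (sq_eq_sq₀ (bracket_pos _).le (bracket_pos _).le).mp h

theorem norm_freqVec_le_bracket (k : Fin 3 → ℤ) : ‖freqVec k‖ ≤ bracket k := by
  rw [bracket]
  split_ifs with hk
  · have : ‖freqVec k‖ ^ 2 = 0 := by rw [norm_freqVec_sq, hk, freqSq_zero]
    rw [pow_eq_zero_iff two_ne_zero] at this
    rw [this]
    exact zero_le_one
  · rfl

theorem bracket_add_le (k l : Fin 3 → ℤ) : bracket (k + l) ≤ bracket k + bracket l := by
  by_cases h : k + l = 0
  · rw [h, bracket_zero]
    linarith [one_le_bracket k, bracket_pos l]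
  · rw [bracket, if_neg h, freqVec_add]
    exact (norm_add_le _ _).trans
      (add_le_add (norm_freqVec_le_bracket k) (norm_freqVec_le_bracket l))

theorem sobolevWeight_eq (s : ℝ) (k : Fin 3 → ℤ) : sobolevWeight s k = (bracket k ^ s) ^ 2 := by
  rw [sobolevWeight]
  split_ifs with hk
  · simp [hk, bracket_zero]
  · rw [← bracket_sq hk, ← Real.rpow_natCast, ← Real.rpow_natCast,
      ← Real.rpow_mul (bracket_pos k).le, ← Real.rpow_mul (bracket_pos k).le, mul_comm]

/-- The frequencies lie in the lattice spanned by the standard basis, of rank `3`, where such sums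
converge below the exponent `-3`. -/
theorem summable_norm_freqVec_rpow {r : ℝ} (hr : r < -3) :
    Summable fun k : Fin 3 → ℤ => ‖freqVec k‖ ^ r := by
  let b := (EuclideanSpace.basisFun (Fin 3) ℝ).toBasis
  let L : Submodule ℤ (EuclideanSpace ℝ (Fin 3)) := Submodule.span ℤ (range b)
  have hL : Module.finrank ℤ L = 3 := by
    rw [Module.finrank_eq_card_basis (b.restrictScalars ℤ)]
    simp
  have hmem : ∀ k, freqVec k ∈ L := fun k => by
    have : freqVec k = ∑ j, k j • b j := by
      ext i
      simp [freqVec, b, Fin.sum_univ_three, EuclideanSpace.basisFun_apply]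
      fin_cases i <;> simp
    rw [this]
    exact Submodule.sum_mem _ fun j _ =>
      Submodule.smul_mem _ _ (Submodule.subset_span (mem_range_self j))
  have h := ZLattice.summable_norm_rpow L r (by rw [hL]; exact_mod_cast hr)
  refine h.comp_injective (i := fun k => (⟨freqVec k, hmem k⟩ : L)) fun k l hkl => ?_
  have h2 : freqVec k = freqVec l := congrArg Subtype.val hkl
  funext j
  have h3 := congrFun (congrArg (WithLp.ofLp) h2) j
  simpa [freqVec] using h3

theorem summable_bracket {s : ℝ} (hs : 3 / 2 < s) :
    Summable fun k : Fin 3 → ℤ => (bracket k ^ (-s)) ^ 2 := by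
  have h := summable_norm_freqVec_rpow (r := -(2 * s)) (by linarith)
  -- The indicator supplies the weight `1` at `k = 0`, where the power of `‖freqVec 0‖ = 0` does
  -- not.
  have h1 : Summable fun k : Fin 3 → ℤ =>
      (if k = 0 then (1 : ℝ) else 0) + ‖freqVec k‖ ^ (-(2 * s)) := by
    refine Summable.add ?_ h
    exact summable_of_ne_finset_zero (s := {0}) fun k hk => if_neg (by simpa using hk)
  refine h1.of_nonneg_of_le (fun k => sq_nonneg _) fun k => ?_
  rw [bracket]
  split_ifs with hk
  · simp only [Real.one_rpow, one_pow, le_add_iff_nonneg_right]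
    positivity
  · rw [zero_add, ← Real.rpow_natCast, ← Real.rpow_mul (norm_nonneg _)]
    apply le_of_eq
    congr 1
    push_cast
    ring

/-- `⟨k + l⟩` is at most twice the larger of the two brackets. -/
theorem bracket_rpow_add_le {s : ℝ} (hs : 0 ≤ s) (k l : Fin 3 → ℤ) :
    bracket (k + l) ^ s ≤ 2 ^ s * (bracket k ^ s + bracket l ^ s) := by
  have hk := bracket_pos k
  have hl := bracket_pos l
  rcases le_total (bracket k) (bracket l) with h | h
  · calc bracket (k + l) ^ s ≤ (2 * bracket l) ^ s := by
          refine Real.rpow_le_rpow (bracket_pos _).le ?_ hs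
          linarith [bracket_add_le k l]
      _ = 2 ^ s * bracket l ^ s := Real.mul_rpow (by norm_num) hl.le
      _ ≤ _ := by
          gcongr
          have := Real.rpow_pos_of_pos hk s
          linarith
  · calc bracket (k + l) ^ s ≤ (2 * bracket k) ^ s := by
          refine Real.rpow_le_rpow (bracket_pos _).le ?_ hs
          linarith [bracket_add_le k l]
      _ = 2 ^ s * bracket k ^ s := Real.mul_rpow (by norm_num) hk.le
      _ ≤ _ := by
          gcongr
          have := Real.rpow_pos_of_pos hl s
          linarith

/-! ### Convolutions and the algebra property of `Hˢ` -/

/-- Translation of sequences. -/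
noncomputable def seqShift (j : Fin 3 → ℤ) (x : SeqSpace) : SeqSpace :=
  ⟨fun k => x (k - j), memℓp_two_iff.mpr
    ((Equiv.subRight j).summable_iff.mpr (SeqSpace.hasSum_norm_sq x).summable)⟩

theorem norm_seqShift (j : Fin 3 → ℤ) (x : SeqSpace) : ‖seqShift j x‖ = ‖x‖ := by
  have h1 := SeqSpace.hasSum_norm_sq (seqShift j x)
  have h2 := (Equiv.subRight j).hasSum_iff.mpr (SeqSpace.hasSum_norm_sq x)
  exact (sq_eq_sq₀ (norm_nonneg _) (norm_nonneg _)).mp (h1.unique h2)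

/-- Young's inequality `ℓ¹ * ℓ² ⊆ ℓ²`. -/
theorem exists_convolution {b : (Fin 3 → ℤ) → ℂ} (hb : Summable fun j => ‖b j‖) (x : SeqSpace) :
    ∃ y : SeqSpace, (∀ k, HasSum (fun j => b j * x (k - j)) (y k)) ∧
      ‖y‖ ≤ (∑' j, ‖b j‖) * ‖x‖ := by
  have hn : ∀ j, ‖b j • seqShift j x‖ = ‖b j‖ * ‖x‖ := fun j => by
    rw [norm_smul, norm_seqShift]
  have hs : Summable fun j => ‖b j • seqShift j x‖ := by
    simp only [hn]
    exact hb.mul_right _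
  -- The convolution is an absolutely convergent series of translates of `x`, each of norm `‖x‖`.
  refine ⟨∑' j, b j • seqShift j x, fun k => ?_, ?_⟩
  · have h := (lp.evalCLM ℂ (fun _ : Fin 3 → ℤ => ℂ) 2 k).hasSum hs.of_norm.hasSum
    exact h
  · refine (norm_tsum_le_tsum_norm hs).trans ?_
    simp only [hn]
    rw [tsum_mul_right]

/-- The sequence of absolute values. -/
noncomputable def absSeq (x : SeqSpace) : SeqSpace :=
  ⟨fun k => (‖x k‖ : ℂ), memℓp_two_iff.mpr
    (by simpa using (SeqSpace.hasSum_norm_sq x).summable)⟩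

theorem absSeq_apply (x : SeqSpace) (k : Fin 3 → ℤ) : absSeq x k = (‖x k‖ : ℂ) := rfl

theorem norm_absSeq (x : SeqSpace) : ‖absSeq x‖ = ‖x‖ := by
  have h1 := SeqSpace.hasSum_norm_sq (absSeq x)
  simp only [absSeq_apply, Complex.norm_real, norm_norm] at h1
  exact (sq_eq_sq₀ (norm_nonneg _) (norm_nonneg _)).mp (h1.unique (SeqSpace.hasSum_norm_sq x))

/-- The embedding constant of `Hˢ` in the Wiener algebra. -/
noncomputable def wienerConst (s : ℝ) : ℝ := √(∑' k : Fin 3 → ℤ, (bracket k ^ (-s)) ^ 2)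

/-- Cauchy–Schwarz: coefficients of functions in `Hˢ` are absolutely summable. -/
theorem summable_bracket_mul {s : ℝ} (hs : 3 / 2 < s) (x : SeqSpace) :
    (Summable fun k => bracket k ^ (-s) * ‖x k‖) ∧
      ∑' k, bracket k ^ (-s) * ‖x k‖ ≤ wienerConst s * ‖x‖ := by
  have hf : ∀ k, 0 ≤ bracket k ^ (-s) := fun k => Real.rpow_nonneg (bracket_pos k).le _
  have hf2 : Summable fun k => (bracket k ^ (-s)) ^ (2 : ℝ) := by simpa using summable_bracket hs
  have hg2 : Summable fun k => ‖x k‖ ^ (2 : ℝ) := by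
    simpa using (SeqSpace.hasSum_norm_sq x).summable
  refine ⟨Real.summable_mul_of_Lp_Lq_of_nonneg Real.HolderConjugate.two_two hf
    (fun k => norm_nonneg _) hf2 hg2, (Real.inner_le_Lp_mul_Lq_tsum_of_nonneg
      Real.HolderConjugate.two_two hf (fun k => norm_nonneg _) hf2 hg2).trans (le_of_eq ?_)⟩
  simp only [Real.rpow_two]
  rw [(SeqSpace.hasSum_norm_sq x).tsum_eq, wienerConst, ← Real.sqrt_eq_rpow, ← Real.sqrt_eq_rpow,
    Real.sqrt_sq (norm_nonneg _)]

theorem bracket_rpow_neg (k : Fin 3 → ℤ) (s : ℝ) : bracket k ^ s * bracket k ^ (-s) = 1 := by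
  rw [← Real.rpow_add (bracket_pos k), add_neg_cancel, Real.rpow_zero]

theorem norm_bracket_rpow_neg_le {s : ℝ} (hs : 0 ≤ s) (k : Fin 3 → ℤ) :
    ‖((bracket k ^ (-s) : ℝ) : ℂ)‖ ≤ 1 := by
  rw [Complex.norm_real, Real.norm_of_nonneg (Real.rpow_nonneg (bracket_pos k).le _)]
  exact Real.rpow_le_one_of_one_le_of_nonpos (one_le_bracket k) (by linarith)

theorem summable_convolution {s : ℝ} (hs : 3 / 2 < s) (x y : SeqSpace) (k : Fin 3 → ℤ) :
    Summable fun j => ((bracket j ^ (-s) : ℝ) : ℂ) * x j *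
      (((bracket (k - j) ^ (-s) : ℝ) : ℂ) * y (k - j)) := by
  have hb : Summable fun j => ‖((bracket j ^ (-s) : ℝ) : ℂ) * x j‖ := by
    refine (summable_bracket_mul hs x).1.congr fun j => ?_
    rw [norm_mul, Complex.norm_real,
      Real.norm_of_nonneg (Real.rpow_nonneg (bracket_pos j).le _)]
  obtain ⟨z, hz, -⟩ := exists_convolution hb
    (diag (fun k => ((bracket k ^ (-s) : ℝ) : ℂ)) y)
  refine (hz k).summable.congr fun j => ?_
  rw [diag_apply (norm_bracket_rpow_neg_le (by linarith))]

/-- Coefficients of a product in `Hˢ`, weighted by `⟨k⟩ˢ`. -/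
noncomputable def convCoeff (s : ℝ) (x y : (Fin 3 → ℤ) → ℂ) (k : Fin 3 → ℤ) : ℂ :=
  ((bracket k ^ s : ℝ) : ℂ) * ∑' j, ((bracket j ^ (-s) : ℝ) : ℂ) * x j *
      (((bracket (k - j) ^ (-s) : ℝ) : ℂ) * y (k - j))

/-- Splitting `⟨k⟩ˢ ≤ 2ˢ (⟨j⟩ˢ + ⟨k-j⟩ˢ)` cancels the weight on one factor and leaves the other
factor in `ℓ¹`. Each half is then an `ℓ¹ * ℓ²` convolution of absolute values. -/
theorem exists_convCoeff_majorant {s : ℝ} (hs : 3 / 2 < s) (x y : SeqSpace) :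
    ∃ z : SeqSpace, (∀ k, ‖convCoeff s x y k‖ ≤ ‖z k‖) ∧
      ‖z‖ ≤ 2 ^ s * (2 * wienerConst s) * ‖x‖ * ‖y‖ := by
  have hβ : ∀ k, 0 ≤ bracket k ^ (-s) := fun k => Real.rpow_nonneg (bracket_pos k).le _
  have hn : ∀ (x : SeqSpace) j,
      ‖((bracket j ^ (-s) * ‖x j‖ : ℝ) : ℂ)‖ = bracket j ^ (-s) * ‖x j‖ := fun x j => by
    rw [Complex.norm_real, Real.norm_of_nonneg (mul_nonneg (hβ j) (norm_nonneg _))]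
  have hb : ∀ x : SeqSpace, Summable fun j => ‖((bracket j ^ (-s) * ‖x j‖ : ℝ) : ℂ)‖ :=
    fun x => by simpa only [hn] using (summable_bracket_mul hs x).1
  obtain ⟨z1, hz1, hz1n⟩ := exists_convolution (hb x) (absSeq y)
  obtain ⟨z2, hz2, hz2n⟩ := exists_convolution (hb y) (absSeq x)
  simp only [hn, norm_absSeq] at hz1n hz2n
  have hw : 0 ≤ wienerConst s := Real.sqrt_nonneg _
  refine ⟨((2 ^ s : ℝ) : ℂ) • (z1 + z2), fun k => ?_, ?_⟩
  · have h1 : HasSum (fun j => bracket j ^ (-s) * ‖x j‖ * ‖y (k - j)‖) (z1 k).re := by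
      have := Complex.hasSum_re (hz1 k)
      refine this.congr_fun fun j => ?_
      rw [absSeq_apply, ← Complex.ofReal_mul, Complex.ofReal_re]
    -- The substitution `j ↦ k - j` puts both convolutions in the same summation variable.
    have h2 : HasSum (fun j => bracket (k - j) ^ (-s) * ‖y (k - j)‖ * ‖x j‖) (z2 k).re := by
      have := (Equiv.subLeft k).hasSum_iff.mpr (Complex.hasSum_re (hz2 k))
      refine this.congr_fun fun j => ?_
      simp only [Function.comp_apply, Equiv.subLeft_apply, sub_sub_cancel]
      rw [absSeq_apply, ← Complex.ofReal_mul, Complex.ofReal_re]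
    have h3 := ((h1.add h2).mul_left (2 ^ s))
    have hterm : ∀ j, ‖((bracket k ^ s : ℝ) : ℂ) * (((bracket j ^ (-s) : ℝ) : ℂ) * x j *
        (((bracket (k - j) ^ (-s) : ℝ) : ℂ) * y (k - j)))‖ ≤
        2 ^ s * (bracket j ^ (-s) * ‖x j‖ * ‖y (k - j)‖ +
          bracket (k - j) ^ (-s) * ‖y (k - j)‖ * ‖x j‖) := fun j => by
      simp only [norm_mul, Complex.norm_real]
      rw [Real.norm_of_nonneg (hβ j), Real.norm_of_nonneg (hβ _),
        Real.norm_of_nonneg (Real.rpow_nonneg (bracket_pos k).le _)]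
      have h4 := bracket_rpow_add_le (s := s) (by linarith) j (k - j)
      rw [add_sub_cancel] at h4
      have e1 := bracket_rpow_neg j s
      have e2 := bracket_rpow_neg (k - j) s
      have hp : 0 ≤ bracket j ^ (-s) * ‖x j‖ * (bracket (k - j) ^ (-s) * ‖y (k - j)‖) :=
        mul_nonneg (mul_nonneg (hβ j) (norm_nonneg _)) (mul_nonneg (hβ _) (norm_nonneg _))
      refine (mul_le_mul_of_nonneg_right h4 hp).trans (le_of_eq ?_)
      linear_combination
        (2 ^ s * ‖x j‖ * bracket (k - j) ^ (-s) * ‖y (k - j)‖) * e1 +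
        (2 ^ s * ‖y (k - j)‖ * bracket j ^ (-s) * ‖x j‖) * e2
    rw [convCoeff, ← tsum_mul_left]
    refine (tsum_of_norm_bounded h3 hterm).trans ?_
    rw [lp.coeFn_smul, Pi.smul_apply, norm_smul, Complex.norm_real,
      Real.norm_of_nonneg (by positivity)]
    gcongr
    rw [lp.coeFn_add, Pi.add_apply, ← Complex.add_re]
    exact Complex.re_le_norm _
  · rw [norm_smul, Complex.norm_real, Real.norm_of_nonneg (by positivity)]
    have hx := (summable_bracket_mul hs x).2
    have hy := (summable_bracket_mul hs y).2
    calc 2 ^ s * ‖z1 + z2‖ ≤ 2 ^ s * (wienerConst s * ‖x‖ * ‖y‖ + wienerConst s * ‖y‖ * ‖x‖) := by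
          gcongr
          refine (norm_add_le _ _).trans (add_le_add (hz1n.trans ?_) (hz2n.trans ?_))
          · gcongr
          · gcongr
      _ = _ := by ring

/-- The algebra property of `Hˢ` for `s > 3/2`, in terms of weighted coefficients. -/
theorem exists_sobolevMul {s : ℝ} (hs : 3 / 2 < s) :
    ∃ B : SeqSpace →L[ℝ] SeqSpace →L[ℝ] SeqSpace, ∀ x y k, B x y k = convCoeff s x y k := by
  have hmem : ∀ x y : SeqSpace, Memℓp (convCoeff s x y) 2 := fun x y => by
    obtain ⟨z, hz, -⟩ := exists_convCoeff_majorant hs x y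
    exact (lp.memℓp z).mono' hz
  let f : SeqSpace →ₗ[ℝ] SeqSpace →ₗ[ℝ] SeqSpace := LinearMap.mk₂ ℝ
    (fun x y => (⟨convCoeff s x y, hmem x y⟩ : SeqSpace))
    (fun x x' y => SeqSpace.ext fun k => by
      change convCoeff s ⇑(x + x') y k = convCoeff s x y k + convCoeff s x' y k
      rw [convCoeff, convCoeff, convCoeff, ← mul_add,
        ← (summable_convolution hs x y k).tsum_add (summable_convolution hs x' y k)]
      congr 1
      refine tsum_congr fun j => ?_
      rw [lp.coeFn_add, Pi.add_apply]
      ring)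
    (fun c x y => SeqSpace.ext fun k => by
      change convCoeff s ⇑(c • x) y k = (c : ℝ) • convCoeff s x y k
      rw [convCoeff, convCoeff, Complex.real_smul, mul_left_comm (c : ℂ),
        ← tsum_mul_left (a := (c : ℂ))]
      congr 1
      refine tsum_congr fun j => ?_
      rw [lp.coeFn_smul, Pi.smul_apply, Complex.real_smul]
      ring)
    (fun x y y' => SeqSpace.ext fun k => by
      change convCoeff s x ⇑(y + y') k = convCoeff s x y k + convCoeff s x y' k
      rw [convCoeff, convCoeff, convCoeff, ← mul_add,
        ← (summable_convolution hs x y k).tsum_add (summable_convolution hs x y' k)]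
      congr 1
      refine tsum_congr fun j => ?_
      rw [lp.coeFn_add, Pi.add_apply]
      ring)
    (fun c x y => SeqSpace.ext fun k => by
      change convCoeff s x ⇑(c • y) k = (c : ℝ) • convCoeff s x y k
      rw [convCoeff, convCoeff, Complex.real_smul, mul_left_comm (c : ℂ),
        ← tsum_mul_left (a := (c : ℂ))]
      congr 1
      refine tsum_congr fun j => ?_
      rw [lp.coeFn_smul, Pi.smul_apply, Complex.real_smul]
      ring)
  refine ⟨f.mkContinuous₂ (2 ^ s * (2 * wienerConst s)) fun x y => ?_, fun x y k => rfl⟩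
  obtain ⟨z, hz, hzn⟩ := exists_convCoeff_majorant hs x y
  exact (lp.norm_mono (by norm_num) hz).trans hzn

/-! ### Weighted coordinates on `Hˢ` and pointwise products -/

open Classical in
/-- The weighted Fourier coefficients `⟨k⟩ˢ û_k` of `u ∈ Hˢ`. -/
noncomputable def sobolevCoords (s : ℝ) (u : L2Torus) : SeqSpace :=
  if h : MemSobolev s u then
    ⟨fun k => ((bracket k ^ s : ℝ) : ℂ) * fourierCoeff3 u k, memℓp_two_iff.mpr (by
      refine Summable.congr h fun k => ?_
      rw [norm_mul, mul_pow, sobolevWeight_eq, Complex.norm_real, Real.norm_eq_abs, sq_abs])⟩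
  else 0

theorem sobolevCoords_apply {s : ℝ} {u : L2Torus} (h : MemSobolev s u) (k : Fin 3 → ℤ) :
    sobolevCoords s u k = ((bracket k ^ s : ℝ) : ℂ) * coeffs u k := by
  rw [sobolevCoords, dif_pos h, coeffs_apply]

theorem coeffs_eq_of_memSobolev {s : ℝ} {u : L2Torus} (h : MemSobolev s u) (k : Fin 3 → ℤ) :
    coeffs u k = ((bracket k ^ (-s) : ℝ) : ℂ) * sobolevCoords s u k := by
  rw [sobolevCoords_apply h, ← mul_assoc, ← Complex.ofReal_mul, mul_comm (bracket k ^ (-s)),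
    bracket_rpow_neg, Complex.ofReal_one, one_mul]

/-- Lets an explicit `ℓ²` sequence prove membership in `Hˢ` and identify the coordinates at once. -/
theorem memSobolev_of_coords {s : ℝ} {u : L2Torus} (x : SeqSpace)
    (h : ∀ k, x k = ((bracket k ^ s : ℝ) : ℂ) * coeffs u k) :
    MemSobolev s u ∧ sobolevCoords s u = x := by
  have h1 : MemSobolev s u := by
    refine (SeqSpace.hasSum_norm_sq x).summable.congr fun k => ?_
    rw [h, norm_mul, mul_pow, sobolevWeight_eq, Complex.norm_real, Real.norm_eq_abs, sq_abs,
      coeffs_apply]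
  exact ⟨h1, SeqSpace.ext fun k => by rw [sobolevCoords_apply h1, h]⟩

theorem sobolevNorm_eq {s : ℝ} {u : L2Torus} (h : MemSobolev s u) :
    sobolevNorm s u = ‖sobolevCoords s u‖ := by
  have h1 : (fun k => sobolevWeight s k * ‖fourierCoeff3 u k‖ ^ 2) =
      fun k => ‖sobolevCoords s u k‖ ^ 2 := funext fun k => by
    rw [sobolevCoords_apply h, norm_mul, mul_pow, sobolevWeight_eq, Complex.norm_real,
      Real.norm_eq_abs, sq_abs, coeffs_apply]
  rw [sobolevNorm, h1, (SeqSpace.hasSum_norm_sq _).tsum_eq, Real.sqrt_sq (norm_nonneg _)]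

theorem sobolevCoords_add {s : ℝ} {u v : L2Torus} (hu : MemSobolev s u) (hv : MemSobolev s v) :
    MemSobolev s (u + v) ∧ sobolevCoords s (u + v) = sobolevCoords s u + sobolevCoords s v := by
  refine memSobolev_of_coords _ fun k => ?_
  rw [lp.coeFn_add, Pi.add_apply, sobolevCoords_apply hu, sobolevCoords_apply hv, map_add,
    lp.coeFn_add, Pi.add_apply, mul_add]

theorem sobolevCoords_sub {s : ℝ} {u v : L2Torus} (hu : MemSobolev s u) (hv : MemSobolev s v) :
    MemSobolev s (u - v) ∧ sobolevCoords s (u - v) = sobolevCoords s u - sobolevCoords s v := by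
  refine memSobolev_of_coords _ fun k => ?_
  rw [lp.coeFn_sub, Pi.sub_apply, sobolevCoords_apply hu, sobolevCoords_apply hv, map_sub,
    lp.coeFn_sub, Pi.sub_apply, mul_sub]

/-- The pointwise product of functions in `Hˢ`, `s > 3/2`, and its Fourier coefficients. -/
theorem exists_mul_memSobolev {s : ℝ} (hs : 3 / 2 < s)
    {B : SeqSpace →L[ℝ] SeqSpace →L[ℝ] SeqSpace} (hB : ∀ x y k, B x y k = convCoeff s x y k)
    {u v : L2Torus} (hu : MemSobolev s u) (hv : MemSobolev s v) :
    ∃ p : L2Torus, MemSobolev s p ∧ (∀ᵐ x ∂torusMeasure, p x = u x * v x) ∧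
      sobolevCoords s p = B (sobolevCoords s u) (sobolevCoords s v) := by
  have hsum : Summable fun k => ‖coeffs u k‖ := by
    refine (summable_bracket_mul hs (sobolevCoords s u)).1.congr fun k => ?_
    rw [coeffs_eq_of_memSobolev hu, norm_mul, Complex.norm_real,
      Real.norm_of_nonneg (Real.rpow_nonneg (bracket_pos k).le _)]
  have hnorm : ∀ k, ‖coeffs u k • torusChar k‖ ≤ ‖coeffs u k‖ := fun k =>
    (ContinuousMap.norm_le _ (norm_nonneg _)).mpr fun x => by
      rw [ContinuousMap.smul_apply, norm_smul, norm_torusChar_apply, mul_one]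
  -- Absolute summability makes the Fourier series converge uniformly. Its sum represents `u`, so
  -- `u` is essentially bounded and `u v` stays in `L²`.
  have hS : Summable fun k => coeffs u k • torusChar k :=
    Summable.of_norm_bounded hsum hnorm
  have hlp : complexify u =
      ContinuousMap.toLp (E := ℂ) 2 torusMeasure ℂ (∑' k, coeffs u k • torusChar k) := by
    have h1 := torusBasis.hasSum_repr (complexify u)
    have h2 := (ContinuousMap.toLp (E := ℂ) 2 torusMeasure ℂ).hasSum hS.hasSum
    refine h1.unique (h2.congr_fun fun k => ?_)
    have h3 : torusBasis k = torusCharLp k := by rw [torusBasis, HilbertBasis.coe_mk]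
    rw [h3, map_smul]
    rfl
  have hux : ∀ᵐ x ∂torusMeasure, HasSum (fun k => coeffs u k * torusChar k x) (u x : ℂ) := by
    have h3 := ContinuousMap.coeFn_toLp (𝕜 := ℂ) (p := 2) torusMeasure
      (∑' k, coeffs u k • torusChar k)
    rw [← hlp] at h3
    filter_upwards [h3, coeFn_complexify u] with x h4 h5
    rw [← h5, h4]
    exact (ContinuousMap.evalCLM ℂ x).hasSum hS.hasSum
  have hbdd : ∀ᵐ x ∂torusMeasure, ‖u x‖ ≤ ∑' k, ‖coeffs u k‖ := by
    filter_upwards [hux] with x hx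
    rw [← Complex.norm_real, ← hx.tsum_eq]
    refine tsum_of_norm_bounded hsum.hasSum fun k => ?_
    rw [norm_mul, norm_torusChar_apply, mul_one]
  have hmem : MemLp (fun x => u x * v x) 2 torusMeasure :=
    (Lp.memLp v).of_le_mul (c := ∑' k, ‖coeffs u k‖)
      ((Lp.aestronglyMeasurable u).mul (Lp.aestronglyMeasurable v)) (by
        filter_upwards [hbdd] with x hx
        rw [norm_mul]
        gcongr)
  have hp := hmem.coeFn_toLp
  have hcoef : ∀ k, coeffs (hmem.toLp _) k = ∑' j, coeffs u j * coeffs v (k - j) := fun k => by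
    have hvi := integrable_torusChar_mul (complexify v)
    have hci : ∀ j, coeffs v j = ∫ x, torusChar (-j) x * complexify v x ∂torusMeasure :=
      fun j => torusBasis_repr _ _
    -- Integrating the series of `u` against `v` term by term turns the product into a convolution
    -- of coefficients.
    have h6 := hasSum_integral_of_summable_integral_norm (μ := torusMeasure)
      (F := fun j x => coeffs u j * (torusChar (-(k - j)) x * complexify v x))
      (fun j => (hvi _).const_mul _) (by
        have : ∀ j, ∫ x, ‖coeffs u j * (torusChar (-(k - j)) x * complexify v x)‖ ∂torusMeasure =
            ‖coeffs u j‖ * ∫ x, ‖complexify v x‖ ∂torusMeasure := fun j => by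
          rw [← integral_const_mul]
          refine integral_congr_ae (Eventually.of_forall fun x => ?_)
          simp only [norm_mul, norm_torusChar_apply, one_mul]
        simp only [this]
        exact hsum.mul_right _)
    simp only [integral_const_mul, ← hci] at h6
    rw [h6.tsum_eq, coeffs_apply, fourierCoeff3]
    refine integral_congr_ae ?_
    filter_upwards [hp, hux, coeFn_complexify v] with x h7 h8 h9
    change torusChar (-k) x * _ = _
    rw [h7, h9, Complex.ofReal_mul, ← h8.tsum_eq, ← tsum_mul_right, ← tsum_mul_left]
    refine tsum_congr fun j => ?_
    rw [neg_sub, sub_eq_neg_add, torusChar_add]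
    ring
  obtain ⟨h10, h11⟩ := memSobolev_of_coords (s := s) (u := hmem.toLp _)
    (B (sobolevCoords s u) (sobolevCoords s v)) fun k => by
      rw [hB, hcoef, convCoeff]
      congr 1
      refine tsum_congr fun j => ?_
      rw [coeffs_eq_of_memSobolev hu, coeffs_eq_of_memSobolev hv]
  exact ⟨_, h10, hp, h11⟩

/-! ### The Duhamel formula for scalar first-order equations -/

theorem duhamel_eq_exp_mul {G : ℝ → ℂ} (c p₀ : ℂ) (t : ℝ) :
    Complex.exp (c * t) * p₀ + ∫ s in (0 : ℝ)..t, Complex.exp (c * (t - s : ℝ)) * G s =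
      Complex.exp (c * t) * (p₀ + ∫ s in (0 : ℝ)..t, Complex.exp (-(c * s)) * G s) := by
  rw [mul_add, ← intervalIntegral.integral_const_mul]
  congr 1
  refine intervalIntegral.integral_congr fun s _ => ?_
  rw [← mul_assoc, ← Complex.exp_add]
  congr 2
  push_cast
  ring

/-- The Duhamel formula solves the scalar equation `p' = c p + G`. -/
theorem hasDerivAt_duhamel {G : ℝ → ℂ} (hG : Continuous G) (c p₀ : ℂ) (t : ℝ) :
    HasDerivAt (fun t : ℝ => Complex.exp (c * t) * p₀ +
        ∫ s in (0 : ℝ)..t, Complex.exp (c * (t - s : ℝ)) * G s)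
      (c * (Complex.exp (c * t) * p₀ +
        ∫ s in (0 : ℝ)..t, Complex.exp (c * (t - s : ℝ)) * G s) + G t) t := by
  simp only [duhamel_eq_exp_mul]
  have h1 : HasDerivAt (fun t : ℝ => Complex.exp (c * t)) (Complex.exp (c * t) * c) t := by
    have := ((Complex.ofRealCLM.hasDerivAt (x := t)).const_mul c).cexp
    simpa using this
  have hc : Continuous fun s : ℝ => Complex.exp (-(c * s)) * G s := by fun_prop
  have h2 := ((hc.integral_hasStrictDerivAt 0 t).hasDerivAt).const_add p₀
  refine (h1.mul h2).congr_deriv ?_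
  have h3 : Complex.exp (c * t) * (Complex.exp (-(c * t)) * G t) = G t := by
    rw [← mul_assoc, ← Complex.exp_add, add_neg_cancel, Complex.exp_zero, one_mul]
  rw [h3]
  ring

/-- Solutions of `p' = c p + G` are given by the Duhamel formula. -/
theorem eq_duhamel_of_hasDerivWithinAt {G p : ℝ → ℂ} (hG : Continuous G) {c : ℂ}
    (hp : ∀ t, 0 ≤ t → HasDerivWithinAt p (c * p t + G t) (Ici 0) t) {t : ℝ} (ht : 0 ≤ t) :
    p t = Complex.exp (c * t) * p 0 + ∫ s in (0 : ℝ)..t, Complex.exp (c * (t - s : ℝ)) * G s := by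
  have hc : Continuous fun s : ℝ => Complex.exp (-(c * s)) * G s := by fun_prop
  have hd : ∀ r : ℝ, 0 ≤ r → HasDerivWithinAt (fun r : ℝ => Complex.exp (-(c * r)) * p r)
      (Complex.exp (-(c * r)) * G r) (Ici 0) r := fun r hr => by
    have h1 : HasDerivAt (fun t : ℝ => Complex.exp (-(c * t))) (Complex.exp (-(c * r)) * -c) r := by
      have := ((Complex.ofRealCLM.hasDerivAt (x := r)).const_mul c).neg.cexp
      simpa using this
    refine (h1.hasDerivWithinAt.mul (hp r hr)).congr_deriv ?_
    ring
  have h2 : ∫ s in (0 : ℝ)..t, Complex.exp (-(c * s)) * G s =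
      Complex.exp (-(c * t)) * p t - Complex.exp (-(c * (0 : ℝ))) * p 0 := by
    refine intervalIntegral.integral_eq_sub_of_hasDeriv_right
      (f := fun r : ℝ => Complex.exp (-(c * r)) * p r) ?_ ?_ (hc.intervalIntegrable 0 t)
    · intro r hr
      rw [uIcc_of_le ht] at hr ⊢
      exact (hd r hr.1).continuousWithinAt.mono Icc_subset_Ici_self
    · intro r hr
      rw [min_eq_left ht] at hr
      exact (hd r hr.1.le).mono (Ioi_subset_Ici hr.1.le)
  rw [duhamel_eq_exp_mul, h2, Complex.ofReal_zero, mul_zero, neg_zero, Complex.exp_zero, one_mul,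
    add_sub_cancel, ← mul_assoc, ← Complex.exp_add, add_neg_cancel, Complex.exp_zero, one_mul]

/-! ### Mild solutions in a Banach space: uniqueness and global existence -/

theorem integral_exp_neg_le {κ : ℝ} (hκ : 0 < κ) (t : ℝ) :
    ∫ s in (0 : ℝ)..t, exp (-κ * s) ≤ 1 / κ := by
  rw [intervalIntegral.integral_comp_mul_left (fun x => exp x) (neg_ne_zero.mpr hκ.ne'),
    integral_exp, mul_zero, Real.exp_zero, smul_eq_mul, inv_neg, neg_mul, ← mul_neg, neg_sub,
    ← one_div]
  have := Real.exp_pos (-κ * t)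
  have h2 : 0 < 1 / κ := one_div_pos.mpr hκ
  nlinarith

section Integral

variable {E : Type*} [NormedAddCommGroup E] [NormedSpace ℝ E]

/-- Integrability of `e^{-κs}` makes the bound independent of `t`; this is what permits a
contraction on the infinite time interval. -/
theorem norm_integral_exp_smul_le {κ c K t : ℝ} (hκ : 0 < κ) (hc : 0 ≤ c) (hK : 0 ≤ K)
    (ht : 0 ≤ t) {S : ℝ → E →L[ℝ] E} (hSb : ∀ t x, ‖S t x‖ ≤ c * ‖x‖) {G : ℝ → E}
    (hG : ∀ s, 0 ≤ s → ‖G s‖ ≤ K) :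
    ‖∫ s in (0 : ℝ)..t, S (t - s) (exp (-κ * s) • G s)‖ ≤ c * K / κ := by
  have h1 : ‖∫ s in (0 : ℝ)..t, S (t - s) (exp (-κ * s) • G s)‖ ≤
      ∫ s in (0 : ℝ)..t, c * K * exp (-κ * s) := by
    refine intervalIntegral.norm_integral_le_of_norm_le ht (Eventually.of_forall fun s hs => ?_)
      (Continuous.intervalIntegrable (by fun_prop) _ _)
    refine (hSb _ _).trans ?_
    rw [norm_smul, Real.norm_of_nonneg (Real.exp_pos _).le]
    calc c * (exp (-κ * s) * ‖G s‖) ≤ c * (exp (-κ * s) * K) := by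
          gcongr
          exact hG s hs.1.le
      _ = _ := by ring
  refine h1.trans ?_
  rw [intervalIntegral.integral_const_mul]
  calc c * K * ∫ s in (0 : ℝ)..t, exp (-κ * s) ≤ c * K * (1 / κ) := by
        gcongr
        exact integral_exp_neg_le hκ t
    _ = _ := by ring

theorem continuous_duhamel {S : ℝ → E →L[ℝ] E} (hS : Continuous fun p : ℝ × E => S p.1 p.2)
    {G : ℝ → E} (hG : Continuous G) : Continuous fun t => ∫ s in (0 : ℝ)..t, S (t - s) (G s) := by
  refine intervalIntegral.continuous_parametric_intervalIntegral_of_continuous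
    (f := fun t s => S (t - s) (G s)) ?_ continuous_id
  exact hS.comp (f := fun p : ℝ × ℝ => (p.1 - p.2, G p.2)) (by fun_prop)

/-- Both curves are bounded on the compact interval `[0, T]`, so a Lipschitz constant valid on
bounded sets suffices for a Grönwall argument. -/
theorem mild_solution_unique {κ c : ℝ} (hκ : 0 < κ) (hc : 0 ≤ c)
    {S : ℝ → E →L[ℝ] E} (hS : Continuous fun p : ℝ × E => S p.1 p.2)
    (hSb : ∀ t x, ‖S t x‖ ≤ c * ‖x‖) {L : ℝ → E} {N : ℝ → E → E}
    (hN : Continuous fun p : ℝ × E => N p.1 p.2)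
    (hNl : ∀ M : ℝ, ∃ l : ℝ, 0 ≤ l ∧
      ∀ t x y, ‖x‖ ≤ M → ‖y‖ ≤ M → ‖N t x - N t y‖ ≤ l * ‖x - y‖)
    {U V : ℝ → E} (hU : Continuous U) (hV : Continuous V)
    (hUe : ∀ t, 0 ≤ t → U t = L t + ∫ s in (0 : ℝ)..t, S (t - s) (exp (-κ * s) • N s (U s)))
    (hVe : ∀ t, 0 ≤ t → V t = L t + ∫ s in (0 : ℝ)..t, S (t - s) (exp (-κ * s) • N s (V s)))
    {T : ℝ} (hT : 0 ≤ T) : U T = V T := by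
  obtain ⟨M1, hM1⟩ := isCompact_Icc.exists_bound_of_continuousOn (hU.continuousOn (s := Icc 0 T))
  obtain ⟨M2, hM2⟩ := isCompact_Icc.exists_bound_of_continuousOn (hV.continuousOn (s := Icc 0 T))
  obtain ⟨l, hl0, hl⟩ := hNl (max M1 M2)
  have hD : Continuous fun t => ‖U t - V t‖ := (hU.sub hV).norm
  have key : ∀ t ∈ Icc 0 T, ‖U t - V t‖ ≤ c * l * ∫ s in (0 : ℝ)..t, ‖U s - V s‖ := by
    intro t ht
    have hi : ∀ {W : ℝ → E}, Continuous W → IntervalIntegrable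
        (fun s => S (t - s) (exp (-κ * s) • N s (W s))) volume 0 t := fun {W} hW => by
      have h1 : Continuous fun s => N s (W s) := hN.comp (f := fun s => (s, W s)) (by fun_prop)
      exact (hS.comp (f := fun s => (t - s, exp (-κ * s) • N s (W s)))
        (by fun_prop)).intervalIntegrable _ _
    rw [hUe t ht.1, hVe t ht.1, add_sub_add_left_eq_sub,
      ← intervalIntegral.integral_sub (hi hU) (hi hV), ← intervalIntegral.integral_const_mul]
    refine intervalIntegral.norm_integral_le_of_norm_le ht.1
      (Eventually.of_forall fun s hs => ?_) ((hD.const_mul _).intervalIntegrable _ _)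
    have hs' : s ∈ Icc 0 T := ⟨hs.1.le, hs.2.trans ht.2⟩
    rw [← map_sub, ← smul_sub]
    refine (hSb _ _).trans ?_
    rw [norm_smul, Real.norm_of_nonneg (Real.exp_pos _).le, mul_assoc]
    refine mul_le_mul_of_nonneg_left ?_ hc
    calc exp (-κ * s) * ‖N s (U s) - N s (V s)‖ ≤ 1 * ‖N s (U s) - N s (V s)‖ := by
          gcongr
          rw [Real.exp_le_one_iff]
          nlinarith [hs.1]
      _ ≤ _ := by
          rw [one_mul]
          exact hl s _ _ ((hM1 s hs').trans (le_max_left _ _)) ((hM2 s hs').trans (le_max_right _ _))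
  have hn : ∀ t, 0 ≤ t → 0 ≤ ∫ s in (0 : ℝ)..t, ‖U s - V s‖ := fun t ht =>
    intervalIntegral.integral_nonneg ht fun _ _ => norm_nonneg _
  have hd : ∀ t, HasDerivAt (fun t => ∫ s in (0 : ℝ)..t, ‖U s - V s‖) ‖U t - V t‖ t := fun t =>
    (hD.integral_hasStrictDerivAt 0 t).hasDerivAt
  -- Grönwall is applied to the integral of `‖U - V‖`, which is differentiable, with zero initial
  -- value.
  have hg := norm_le_gronwallBound_of_norm_deriv_right_le (δ := 0) (K := c * l) (ε := 0)
    (a := 0) (b := T) (f := fun t => ∫ s in (0 : ℝ)..t, ‖U s - V s‖)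
    (f' := fun t => ‖U t - V t‖)
    (fun t _ => (hd t).continuousAt.continuousWithinAt) (fun t _ => (hd t).hasDerivWithinAt)
    (by simp) (fun t ht => by
      rw [norm_norm, Real.norm_of_nonneg (hn t ht.1), add_zero]
      exact key t ⟨ht.1, ht.2.le⟩) T ⟨hT, le_rfl⟩
  rw [gronwallBound_ε0_δ0] at hg
  have h0 : ∫ s in (0 : ℝ)..T, ‖U s - V s‖ = 0 := norm_le_zero_iff.mp hg
  have := key T ⟨hT, le_rfl⟩
  rw [h0, mul_zero] at this
  exact sub_eq_zero.mp (norm_le_zero_iff.mp this)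

variable [CompleteSpace E]

/-- Global mild solutions of small nonlinear perturbations with exponentially decaying factor. -/
theorem exists_mild_solution {κ c K l M M₀ : ℝ} (hκ : 0 < κ) (hc : 0 ≤ c) (hK : 0 ≤ K)
    (hl : 0 ≤ l) {S : ℝ → E →L[ℝ] E} (hS : Continuous fun p : ℝ × E => S p.1 p.2)
    (hSb : ∀ t x, ‖S t x‖ ≤ c * ‖x‖) {L : ℝ → E} (hL : Continuous L)
    (hLb : ∀ t, 0 ≤ t → ‖L t‖ ≤ M₀) {N : ℝ → E → E}
    (hN : Continuous fun p : ℝ × E => N p.1 p.2)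
    (hNb : ∀ t x, ‖x‖ ≤ M → ‖N t x‖ ≤ K)
    (hNl : ∀ t x y, ‖x‖ ≤ M → ‖y‖ ≤ M → ‖N t x - N t y‖ ≤ l * ‖x - y‖)
    (hM : M₀ + c * K / κ ≤ M) (hcl : c * l / κ ≤ 1 / 2) :
    ∃ U : ℝ → E, Continuous U ∧ (∀ t, ‖U t‖ ≤ M) ∧
      ∀ t, 0 ≤ t → U t = L t + ∫ s in (0 : ℝ)..t, S (t - s) (exp (-κ * s) • N s (U s)) := by
  have hM₀ : 0 ≤ M₀ := (norm_nonneg _).trans (hLb 0 le_rfl)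
  have hM0 : 0 ≤ M := le_trans (by positivity) hM
  let α := Metric.closedBall (0 : ℝ →ᵇ E) M
  have hα : ∀ (U : α) t, ‖(U : ℝ →ᵇ E) t‖ ≤ M := fun U t =>
    ((U : ℝ →ᵇ E).norm_coe_le_norm t).trans (mem_closedBall_zero_iff.mp U.2)
  let F : α → ℝ → E := fun U t =>
    L t + ∫ s in (0 : ℝ)..t, S (t - s) (exp (-κ * s) • N s ((U : ℝ →ᵇ E) s))
  have hint : ∀ U : α, Continuous fun s => exp (-κ * s) • N s ((U : ℝ →ᵇ E) s) := fun U => by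
    have : Continuous fun s => N s ((U : ℝ →ᵇ E) s) :=
      hN.comp (f := fun s => (s, (U : ℝ →ᵇ E) s)) (by fun_prop)
    fun_prop
  have hF : ∀ U, Continuous (F U) := fun U => hL.add (continuous_duhamel hS (hint U))
  have hFb : ∀ U t, 0 ≤ t → ‖F U t‖ ≤ M := fun U t ht => by
    refine (norm_add_le _ _).trans (le_trans (add_le_add (hLb t ht) ?_) hM)
    exact norm_integral_exp_smul_le hκ hc hK ht hSb fun s _ => hNb s _ (hα U s)
  -- Freezing the value at negative times by `max t 0` allows bounded continuous functions on all of
  -- `ℝ`.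
  let Φ : α → α := fun U => ⟨BoundedContinuousFunction.ofNormedAddCommGroup
    (fun t => F U (max t 0)) ((hF U).comp (by fun_prop)) M fun t => hFb U _ (le_max_right _ _),
    mem_closedBall_zero_iff.mpr (BoundedContinuousFunction.norm_ofNormedAddCommGroup_le _ hM0 _)⟩
  have hΦ : ContractingWith (1 / 2) Φ := by
    refine ⟨by rw [← NNReal.coe_lt_coe]; norm_num, LipschitzWith.of_dist_le_mul fun U V => ?_⟩
    rw [Subtype.dist_eq, BoundedContinuousFunction.dist_le (by positivity)]
    intro t
    change dist (F U (max t 0)) (F V (max t 0)) ≤ _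
    set r := max t 0
    have hr : 0 ≤ r := le_max_right _ _
    have hi : ∀ U : α, IntervalIntegrable
        (fun s => S (r - s) (exp (-κ * s) • N s ((U : ℝ →ᵇ E) s))) volume 0 r := fun U =>
      (hS.comp (f := fun s => (r - s, exp (-κ * s) • N s ((U : ℝ →ᵇ E) s)))
        ((by fun_prop : Continuous fun s => r - s).prodMk (hint U))).intervalIntegrable _ _
    have h1 : F U r - F V r = ∫ s in (0 : ℝ)..r, S (r - s)
        (exp (-κ * s) • (N s ((U : ℝ →ᵇ E) s) - N s ((V : ℝ →ᵇ E) s))) := by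
      simp only [F, add_sub_add_left_eq_sub]
      rw [← intervalIntegral.integral_sub (hi U) (hi V)]
      refine intervalIntegral.integral_congr fun s _ => ?_
      simp only [smul_sub, map_sub]
    rw [dist_eq_norm, h1]
    refine (norm_integral_exp_smul_le (K := l * dist U V) hκ hc (by positivity) hr hSb
      fun s _ => ?_).trans ?_
    · refine (hNl s _ _ (hα U s) (hα V s)).trans ?_
      gcongr
      rw [← dist_eq_norm]
      exact BoundedContinuousFunction.dist_coe_le_dist (f := (U : ℝ →ᵇ E)) s
    · calc c * (l * dist U V) / κ = c * l / κ * dist U V := by ring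
        _ ≤ 1 / 2 * dist U V := by gcongr
        _ = _ := by simp
  have : CompleteSpace α := Metric.isClosed_closedBall.completeSpace_coe
  have : Nonempty α := ⟨⟨0, Metric.mem_closedBall_self hM0⟩⟩
  set U := hΦ.fixedPoint
  have hU : Φ U = U := hΦ.fixedPoint_isFixedPt
  refine ⟨(U : ℝ →ᵇ E), (U : ℝ →ᵇ E).continuous, hα U, fun t ht => ?_⟩
  have h2 : (Φ U : ℝ →ᵇ E) t = (U : ℝ →ᵇ E) t := by rw [hU]
  rw [← h2]
  change F U (max t 0) = _
  rw [max_eq_left ht]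

end Integral

/-! ### Characteristic roots of the damped wave equation -/

/-- Half of the difference of the characteristic roots of `y'' + 2κ y' + |k|² y = 0`. -/
noncomputable def halfGap (κ : ℝ) (k : Fin 3 → ℤ) : ℂ :=
  if k = 0 then (κ : ℂ) else Complex.I * (√(freqSq k - κ ^ 2) : ℝ)

/-- The characteristic roots `-κ + σ √(κ² - |k|²)`, `σ = ±1`. -/
noncomputable def charRoot (σ κ : ℝ) (k : Fin 3 → ℤ) : ℂ := -κ + σ * halfGap κ k

theorem abs_neg_one : |(-1 : ℝ)| = 1 := by norm_num

section Symbols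

variable {κ σ : ℝ}

/-- The discriminant `κ² - |k|²` is `κ²` at `k = 0` and negative elsewhere, because `κ < 1 ≤ |k|`.
In both cases `halfGap` is a square root of it. -/
theorem halfGap_sq (hκ0 : 0 < κ) (hκ1 : κ < 1) (k : Fin 3 → ℤ) :
    halfGap κ k ^ 2 = κ ^ 2 - freqSq k := by
  rw [halfGap]
  split_ifs with hk
  · rw [hk, freqSq_zero, Complex.ofReal_zero, sub_zero]
  · have h : 0 ≤ freqSq k - κ ^ 2 := by nlinarith [one_le_freqSq hk]
    rw [mul_pow, Complex.I_sq, ← Complex.ofReal_pow, Real.sq_sqrt h]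
    push_cast
    ring

theorem norm_halfGap_zero (hκ0 : 0 < κ) : ‖halfGap κ 0‖ = κ := by
  rw [halfGap, if_pos rfl, Complex.norm_real, Real.norm_of_nonneg hκ0.le]

theorem norm_halfGap {k : Fin 3 → ℤ} (hk : k ≠ 0) : ‖halfGap κ k‖ = √(freqSq k - κ ^ 2) := by
  rw [halfGap, if_neg hk, norm_mul, Complex.norm_I, one_mul, Complex.norm_real,
    Real.norm_of_nonneg (Real.sqrt_nonneg _)]

theorem halfGap_ne_zero (hκ0 : 0 < κ) (hκ1 : κ < 1) (k : Fin 3 → ℤ) : halfGap κ k ≠ 0 := by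
  rw [← norm_pos_iff]
  by_cases hk : k = 0
  · rw [hk, norm_halfGap_zero hκ0]
    exact hκ0
  · rw [norm_halfGap hk]
    refine Real.sqrt_pos.mpr ?_
    nlinarith [one_le_freqSq hk]

theorem norm_halfGap_le (hκ0 : 0 < κ) (hκ1 : κ < 1) (k : Fin 3 → ℤ) :
    ‖halfGap κ k‖ ≤ bracket k := by
  by_cases hk : k = 0
  · rw [hk, norm_halfGap_zero hκ0, bracket_zero]
    exact hκ1.le
  · rw [norm_halfGap hk, ← bracket_sq hk]
    refine Real.sqrt_le_iff.mpr ⟨(bracket_pos k).le, ?_⟩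
    nlinarith

theorem norm_charRoot_le (hκ0 : 0 < κ) (hκ1 : κ < 1) (hσ : |σ| = 1) (k : Fin 3 → ℤ) :
    ‖charRoot σ κ k‖ ≤ 2 * bracket k := by
  have h := norm_halfGap_le hκ0 hκ1 k
  calc ‖charRoot σ κ k‖ ≤ ‖-(κ : ℂ)‖ + ‖(σ : ℂ) * halfGap κ k‖ := norm_add_le _ _
    _ = κ + ‖halfGap κ k‖ := by
      rw [norm_neg, norm_mul, Complex.norm_real, Complex.norm_real, Real.norm_of_nonneg hκ0.le,
        Real.norm_eq_abs, hσ, one_mul]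
    _ ≤ _ := by linarith [one_le_bracket k]

/-- The norm of the Duhamel operator `Hᵐ → H^{m+1}`, up to a factor `2`. -/
noncomputable def gainConst (κ : ℝ) : ℝ := 1 / κ + 1 / √(1 - κ ^ 2)

theorem gainConst_pos (hκ0 : 0 < κ) : 0 < gainConst κ :=
  add_pos_of_pos_of_nonneg (by positivity) (by positivity)

/-- For `k ≠ 0`, `|k|² - κ² ≥ (1 - κ²)|k|²`, which uses the second term of `gainConst`; its first
term serves `k = 0`. This is the gain of one derivative. -/
theorem bracket_le_gainConst_mul (hκ0 : 0 < κ) (hκ1 : κ < 1) (k : Fin 3 → ℤ) :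
    bracket k ≤ gainConst κ * ‖halfGap κ k‖ := by
  have h1 : 0 < 1 - κ ^ 2 := by nlinarith
  have h2 : 0 < √(1 - κ ^ 2) := Real.sqrt_pos.mpr h1
  by_cases hk : k = 0
  · rw [hk, norm_halfGap_zero hκ0, bracket_zero, gainConst, add_mul, one_div_mul_cancel hκ0.ne']
    have : 0 ≤ 1 / √(1 - κ ^ 2) * κ := by positivity
    linarith
  · have h3 : √(1 - κ ^ 2) * bracket k ≤ √(freqSq k - κ ^ 2) := by
      rw [← Real.sqrt_sq (bracket_pos k).le, ← Real.sqrt_mul h1.le, bracket_sq hk]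
      refine Real.sqrt_le_sqrt ?_
      nlinarith [one_le_freqSq hk]
    rw [norm_halfGap hk, gainConst, add_mul]
    have h4 : bracket k ≤ 1 / √(1 - κ ^ 2) * √(freqSq k - κ ^ 2) := by
      rw [one_div, ← div_eq_inv_mul, le_div_iff₀ h2, mul_comm]
      exact h3
    have : 0 ≤ 1 / κ * √(freqSq k - κ ^ 2) := by positivity
    linarith

theorem norm_bracket_div_le (hκ0 : 0 < κ) (hκ1 : κ < 1) (k : Fin 3 → ℤ) :
    ‖(bracket k : ℂ) / (2 * halfGap κ k)‖ ≤ gainConst κ := by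
  have h0 : 0 < ‖halfGap κ k‖ := norm_pos_iff.mpr (halfGap_ne_zero hκ0 hκ1 k)
  rw [norm_div, norm_mul, Complex.norm_real, Real.norm_of_nonneg (bracket_pos k).le,
    Complex.norm_ofNat, div_le_iff₀ (by positivity)]
  have := bracket_le_gainConst_mul hκ0 hκ1 k
  nlinarith [bracket_pos k]

theorem norm_charRoot_div_le (hκ0 : 0 < κ) (hκ1 : κ < 1) (hσ : |σ| = 1) (k : Fin 3 → ℤ) :
    ‖charRoot σ κ k / (2 * halfGap κ k)‖ ≤ gainConst κ := by
  have h0 : 0 < ‖halfGap κ k‖ := norm_pos_iff.mpr (halfGap_ne_zero hκ0 hκ1 k)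
  rw [norm_div, norm_mul, Complex.norm_ofNat, div_le_iff₀ (by positivity)]
  have := bracket_le_gainConst_mul hκ0 hκ1 k
  have := norm_charRoot_le hκ0 hκ1 hσ k
  linarith

theorem norm_charRoot_div_bracket_le (hκ0 : 0 < κ) (hκ1 : κ < 1) (hσ : |σ| = 1)
    (k : Fin 3 → ℤ) : ‖charRoot σ κ k / (bracket k : ℂ)‖ ≤ 2 := by
  rw [norm_div, Complex.norm_real, Real.norm_of_nonneg (bracket_pos k).le,
    div_le_iff₀ (bracket_pos k)]
  exact norm_charRoot_le hκ0 hκ1 hσ k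

theorem re_charRoot {k : Fin 3 → ℤ} (hk : k ≠ 0) : (charRoot σ κ k).re = -κ := by
  simp [charRoot, halfGap, hk]

theorem charRoot_zero : charRoot σ κ 0 = ((-κ + σ * κ : ℝ) : ℂ) := by
  simp [charRoot, halfGap]

/-- The real part of the root is `-κ` off the zero mode and `-κ + σκ ≤ 0` on it. The clamp `max t 0`
keeps the bound at negative times. -/
theorem norm_exp_charRoot_le (hκ0 : 0 < κ) (hσ : |σ| = 1) (t : ℝ) (k : Fin 3 → ℤ) :
    ‖Complex.exp (charRoot σ κ k * (max t 0 : ℝ))‖ ≤ 1 := by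
  have ht : 0 ≤ max t 0 := le_max_right _ _
  rw [Complex.norm_exp, Complex.re_mul_ofReal, Real.exp_le_one_iff]
  by_cases hk : k = 0
  · rw [hk, charRoot_zero, Complex.ofReal_re]
    have := le_abs_self σ
    rw [hσ] at this
    refine mul_nonpos_of_nonpos_of_nonneg ?_ ht
    nlinarith
  · rw [re_charRoot hk]
    nlinarith

theorem norm_exp_charRoot_neg_one_le (hκ0 : 0 < κ) (t : ℝ) (k : Fin 3 → ℤ) :
    ‖Complex.exp (charRoot (-1) κ k * (max t 0 : ℝ))‖ ≤ exp (-κ * max t 0) := by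
  have ht : 0 ≤ max t 0 := le_max_right _ _
  rw [Complex.norm_exp, Complex.re_mul_ofReal, Real.exp_le_exp]
  refine mul_le_mul_of_nonneg_right ?_ ht
  by_cases hk : k = 0
  · rw [hk, charRoot_zero, Complex.ofReal_re]
    linarith
  · rw [re_charRoot hk]

theorem norm_exp_charRoot_le_of_ne_zero (t : ℝ) {k : Fin 3 → ℤ} (hk : k ≠ 0) :
    ‖Complex.exp (charRoot σ κ k * (max t 0 : ℝ))‖ ≤ exp (-κ * max t 0) := by
  rw [Complex.norm_exp, Complex.re_mul_ofReal, re_charRoot hk]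

end Symbols

/-! ### Propagators of the first-order factors -/

/-- The semigroup `e^{t λ_σ}` acting on Fourier coefficients, for `t ≥ 0`. -/
noncomputable def waveSemigroup (σ κ t : ℝ) : SeqSpace →L[ℝ] SeqSpace :=
  (diag fun k => Complex.exp (charRoot σ κ k * (max t 0 : ℝ))).restrictScalars ℝ

/-- The map `p ↦ p / (λ₊ - λ₋)` from `Hᵐ` to `H^{m+1}`. -/
noncomputable def gapLift (κ : ℝ) : SeqSpace →L[ℝ] SeqSpace :=
  (diag fun k => (bracket k : ℂ) / (2 * halfGap κ k)).restrictScalars ℝ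

/-- The map `p ↦ λ_σ p / (λ₊ - λ₋)` on `Hᵐ`. -/
noncomputable def gapVelocity (σ κ : ℝ) : SeqSpace →L[ℝ] SeqSpace :=
  (diag fun k => charRoot σ κ k / (2 * halfGap κ k)).restrictScalars ℝ

/-- The value at time `0` of `p_σ = ∂ₜu - λ_{-σ} u`. -/
noncomputable def charData (σ κ : ℝ) (x₀ y₀ : SeqSpace) : SeqSpace :=
  -- `x₀` carries the weight `⟨k⟩^{m+1}` and `y₀` the weight `⟨k⟩ᵐ`, hence the division by `⟨k⟩`.
  y₀ - diag (fun k => charRoot (-σ) κ k / (bracket k : ℂ)) x₀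

/-- The mild solution of `p' = λ_σ p + G`, `p(0) = p₀`. -/
noncomputable def charMild (σ κ : ℝ) (p₀ : SeqSpace) (G : ℝ → SeqSpace) (t : ℝ) : SeqSpace :=
  waveSemigroup σ κ t p₀ + ∫ s in (0 : ℝ)..t, waveSemigroup σ κ (t - s) (G s)

section Operators

variable {κ σ : ℝ}

theorem waveSemigroup_apply (hκ0 : 0 < κ) (hσ : |σ| = 1) (t : ℝ) (x : SeqSpace)
    (k : Fin 3 → ℤ) :
    waveSemigroup σ κ t x k = Complex.exp (charRoot σ κ k * (max t 0 : ℝ)) * x k :=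
  diag_apply (norm_exp_charRoot_le hκ0 hσ t) x k

theorem norm_waveSemigroup_le (hκ0 : 0 < κ) (hσ : |σ| = 1) (t : ℝ) (x : SeqSpace) :
    ‖waveSemigroup σ κ t x‖ ≤ ‖x‖ := by
  have := norm_diag_apply_le (norm_exp_charRoot_le hκ0 hσ t) x
  rwa [one_mul] at this

theorem continuous_waveSemigroup (hκ0 : 0 < κ) (hσ : |σ| = 1) :
    Continuous fun p : ℝ × SeqSpace => waveSemigroup σ κ p.1 p.2 :=
  continuous_diag_uncurry (c := fun t k => Complex.exp (charRoot σ κ k * (max t 0 : ℝ)))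
    (norm_exp_charRoot_le hκ0 hσ) fun _ => Complex.continuous_exp.comp
      (continuous_const.mul (Complex.continuous_ofReal.comp (continuous_id.max continuous_const)))

theorem gapLift_apply (hκ0 : 0 < κ) (hκ1 : κ < 1) (x : SeqSpace) (k : Fin 3 → ℤ) :
    gapLift κ x k = (bracket k : ℂ) / (2 * halfGap κ k) * x k :=
  diag_apply (norm_bracket_div_le hκ0 hκ1) x k

theorem norm_gapLift_le (hκ0 : 0 < κ) (hκ1 : κ < 1) (x : SeqSpace) :
    ‖gapLift κ x‖ ≤ gainConst κ * ‖x‖ :=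
  norm_diag_apply_le (norm_bracket_div_le hκ0 hκ1) x

theorem gapVelocity_apply (hκ0 : 0 < κ) (hκ1 : κ < 1) (hσ : |σ| = 1) (x : SeqSpace)
    (k : Fin 3 → ℤ) :
    gapVelocity σ κ x k = charRoot σ κ k / (2 * halfGap κ k) * x k :=
  diag_apply (norm_charRoot_div_le hκ0 hκ1 hσ) x k

theorem charData_apply (hκ0 : 0 < κ) (hκ1 : κ < 1) (hσ : |σ| = 1) (x₀ y₀ : SeqSpace)
    (k : Fin 3 → ℤ) :
    charData σ κ x₀ y₀ k = y₀ k - charRoot (-σ) κ k / (bracket k : ℂ) * x₀ k := by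
  rw [charData, lp.coeFn_sub, Pi.sub_apply,
    diag_apply (norm_charRoot_div_bracket_le hκ0 hκ1 (by rwa [abs_neg]))]

theorem norm_charData_le (hκ0 : 0 < κ) (hκ1 : κ < 1) (hσ : |σ| = 1) (x₀ y₀ : SeqSpace) :
    ‖charData σ κ x₀ y₀‖ ≤ ‖y₀‖ + 2 * ‖x₀‖ :=
  (norm_sub_le _ _).trans (by
    gcongr
    exact norm_diag_apply_le (norm_charRoot_div_bracket_le hκ0 hκ1 (by rwa [abs_neg])) x₀)

theorem continuous_charMild (hκ0 : 0 < κ) (hσ : |σ| = 1) (p₀ : SeqSpace) {G : ℝ → SeqSpace}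
    (hG : Continuous G) : Continuous (charMild σ κ p₀ G) :=
  ((continuous_waveSemigroup hκ0 hσ).comp (f := fun t => (t, p₀)) (by fun_prop)).add
    (continuous_duhamel (continuous_waveSemigroup hκ0 hσ) hG)

theorem waveSemigroup_intervalIntegrable (hκ0 : 0 < κ) (hσ : |σ| = 1) {G : ℝ → SeqSpace}
    (hG : Continuous G) (t : ℝ) :
    IntervalIntegrable (fun s => waveSemigroup σ κ (t - s) (G s)) volume 0 t :=
  ((continuous_waveSemigroup hκ0 hσ).comp (f := fun s => (t - s, G s))
    (by fun_prop)).intervalIntegrable _ _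

theorem charMild_apply (hκ0 : 0 < κ) (hσ : |σ| = 1) (p₀ : SeqSpace) {G : ℝ → SeqSpace}
    (hG : Continuous G) {t : ℝ} (ht : 0 ≤ t) (k : Fin 3 → ℤ) :
    charMild σ κ p₀ G t k = Complex.exp (charRoot σ κ k * t) * p₀ k +
      ∫ s in (0 : ℝ)..t, Complex.exp (charRoot σ κ k * (t - s : ℝ)) * G s k := by
  have h1 : (∫ s in (0 : ℝ)..t, waveSemigroup σ κ (t - s) (G s)) k =
      ∫ s in (0 : ℝ)..t, waveSemigroup σ κ (t - s) (G s) k :=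
    ((coordL k).intervalIntegral_comp_comm (waveSemigroup_intervalIntegrable hκ0 hσ hG t)).symm
  rw [charMild, lp.coeFn_add, Pi.add_apply, h1, waveSemigroup_apply hκ0 hσ, max_eq_left ht]
  congr 1
  refine intervalIntegral.integral_congr fun s hs => ?_
  rw [uIcc_of_le ht] at hs
  simp only
  rw [waveSemigroup_apply hκ0 hσ, max_eq_left (sub_nonneg.mpr hs.2)]

theorem hasDerivWithinAt_charMild (hκ0 : 0 < κ) (hσ : |σ| = 1) (p₀ : SeqSpace)
    {G : ℝ → SeqSpace} (hG : Continuous G) {t : ℝ} (ht : 0 ≤ t) (k : Fin 3 → ℤ) :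
    HasDerivWithinAt (fun t => charMild σ κ p₀ G t k)
      (charRoot σ κ k * charMild σ κ p₀ G t k + G t k) (Ici 0) t := by
  have hGk : Continuous fun s => G s k := (coordL k).continuous.comp hG
  have h := (hasDerivAt_duhamel hGk (charRoot σ κ k) (p₀ k) t).hasDerivWithinAt (s := Ici 0)
  rw [← charMild_apply hκ0 hσ p₀ hG ht k] at h
  exact h.congr (fun s hs => charMild_apply hκ0 hσ p₀ hG hs k)
    (charMild_apply hκ0 hσ p₀ hG ht k)

end Operators

/-! ### The linear damped wave equation -/

/-- The solution of the linear damped wave equation with forcing `G`, in weighted coefficients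
of `H^{m+1}`. -/
noncomputable def linWave (κ : ℝ) (x₀ y₀ : SeqSpace) (G : ℝ → SeqSpace) (t : ℝ) : SeqSpace :=
  gapLift κ (charMild 1 κ (charData 1 κ x₀ y₀) G t - charMild (-1) κ (charData (-1) κ x₀ y₀) G t)

/-- The time derivative of `linWave`, in weighted coefficients of `Hᵐ`. -/
noncomputable def linWaveDeriv (κ : ℝ) (x₀ y₀ : SeqSpace) (G : ℝ → SeqSpace) (t : ℝ) : SeqSpace :=
  gapVelocity 1 κ (charMild 1 κ (charData 1 κ x₀ y₀) G t) -
    gapVelocity (-1) κ (charMild (-1) κ (charData (-1) κ x₀ y₀) G t)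

section LinWave

variable {κ : ℝ}

/-- From `p_± = ∂ₜu - λ_∓ u` come `p₊ - p₋ = (λ₊ - λ₋) u` and `λ₊ p₊ - λ₋ p₋ = (λ₊ - λ₋) ∂ₜu`. The
factor `⟨k⟩` passes from the weight of `Hᵐ` to that of `H^{m+1}`. -/
theorem linWave_apply (hκ0 : 0 < κ) (hκ1 : κ < 1) (x₀ y₀ : SeqSpace) (G : ℝ → SeqSpace) (t : ℝ)
    (k : Fin 3 → ℤ) :
    linWave κ x₀ y₀ G t k = (bracket k : ℂ) * ((charMild 1 κ (charData 1 κ x₀ y₀) G t k -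
      charMild (-1) κ (charData (-1) κ x₀ y₀) G t k) / (2 * halfGap κ k)) := by
  rw [linWave, gapLift_apply hκ0 hκ1, lp.coeFn_sub, Pi.sub_apply]
  ring

theorem linWaveDeriv_apply (hκ0 : 0 < κ) (hκ1 : κ < 1) (x₀ y₀ : SeqSpace) (G : ℝ → SeqSpace)
    (t : ℝ) (k : Fin 3 → ℤ) :
    linWaveDeriv κ x₀ y₀ G t k =
      (charRoot 1 κ k * charMild 1 κ (charData 1 κ x₀ y₀) G t k -
        charRoot (-1) κ k * charMild (-1) κ (charData (-1) κ x₀ y₀) G t k) /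
          (2 * halfGap κ k) := by
  rw [linWaveDeriv, lp.coeFn_sub, Pi.sub_apply, gapVelocity_apply hκ0 hκ1 abs_one,
    gapVelocity_apply hκ0 hκ1 (by norm_num)]
  ring

theorem continuous_linWave (hκ0 : 0 < κ) (x₀ y₀ : SeqSpace) {G : ℝ → SeqSpace}
    (hG : Continuous G) : Continuous (linWave κ x₀ y₀ G) :=
  (gapLift κ).continuous.comp ((continuous_charMild hκ0 abs_one _ hG).sub
    (continuous_charMild hκ0 (by norm_num) _ hG))

theorem continuous_linWaveDeriv (hκ0 : 0 < κ) (x₀ y₀ : SeqSpace) {G : ℝ → SeqSpace}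
    (hG : Continuous G) : Continuous (linWaveDeriv κ x₀ y₀ G) :=
  ((gapVelocity 1 κ).continuous.comp (continuous_charMild hκ0 abs_one _ hG)).sub
    ((gapVelocity (-1) κ).continuous.comp (continuous_charMild hκ0 (by norm_num) _ hG))

theorem charMild_zero (hκ0 : 0 < κ) {σ : ℝ} (hσ : |σ| = 1) (p₀ : SeqSpace) {G : ℝ → SeqSpace}
    (hG : Continuous G) (k : Fin 3 → ℤ) : charMild σ κ p₀ G 0 k = p₀ k := by
  simp [charMild_apply hκ0 hσ p₀ hG le_rfl]

theorem charRoot_one_sub (k : Fin 3 → ℤ) :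
    charRoot 1 κ k - charRoot (-1) κ k = 2 * halfGap κ k := by
  simp only [charRoot]
  push_cast
  ring

theorem charRoot_sq (hκ0 : 0 < κ) (hκ1 : κ < 1) {σ : ℝ} (hσ : |σ| = 1) (k : Fin 3 → ℤ) :
    charRoot σ κ k ^ 2 = -2 * κ * charRoot σ κ k - freqSq k := by
  have h := halfGap_sq hκ0 hκ1 k
  have h2 : (σ : ℂ) ^ 2 = 1 := by
    rw [← Complex.ofReal_pow, ← sq_abs, hσ, one_pow, Complex.ofReal_one]
  simp only [charRoot]
  linear_combination (σ : ℂ) ^ 2 * h + (κ ^ 2 - freqSq k : ℂ) * h2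

theorem linWave_zero (hκ0 : 0 < κ) (hκ1 : κ < 1) (x₀ y₀ : SeqSpace) {G : ℝ → SeqSpace}
    (hG : Continuous G) : linWave κ x₀ y₀ G 0 = x₀ := by
  refine SeqSpace.ext fun k => ?_
  have hb : (bracket k : ℂ) ≠ 0 := Complex.ofReal_ne_zero.mpr (bracket_pos k).ne'
  have hg := halfGap_ne_zero hκ0 hκ1 k
  have h := charRoot_one_sub (κ := κ) k
  rw [linWave_apply hκ0 hκ1, charMild_zero hκ0 abs_one _ hG,
    charMild_zero hκ0 (by norm_num) _ hG, charData_apply hκ0 hκ1 abs_one,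
    charData_apply hκ0 hκ1 (by norm_num), neg_neg]
  field_simp
  linear_combination x₀ k * h

theorem linWaveDeriv_zero (hκ0 : 0 < κ) (hκ1 : κ < 1) (x₀ y₀ : SeqSpace) {G : ℝ → SeqSpace}
    (hG : Continuous G) : linWaveDeriv κ x₀ y₀ G 0 = y₀ := by
  refine SeqSpace.ext fun k => ?_
  have hb : (bracket k : ℂ) ≠ 0 := Complex.ofReal_ne_zero.mpr (bracket_pos k).ne'
  have hg := halfGap_ne_zero hκ0 hκ1 k
  have h := charRoot_one_sub (κ := κ) k
  rw [linWaveDeriv_apply hκ0 hκ1, charMild_zero hκ0 abs_one _ hG,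
    charMild_zero hκ0 (by norm_num) _ hG, charData_apply hκ0 hκ1 abs_one,
    charData_apply hκ0 hκ1 (by norm_num), neg_neg]
  field_simp
  linear_combination bracket k * y₀ k * h

theorem hasDerivWithinAt_linWave (hκ0 : 0 < κ) (hκ1 : κ < 1) (x₀ y₀ : SeqSpace)
    {G : ℝ → SeqSpace} (hG : Continuous G) {t : ℝ} (ht : 0 ≤ t) (k : Fin 3 → ℤ) :
    HasDerivWithinAt (fun t => linWave κ x₀ y₀ G t k)
      ((bracket k : ℂ) * linWaveDeriv κ x₀ y₀ G t k) (Ici 0) t := by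
  have h1 := hasDerivWithinAt_charMild hκ0 abs_one (charData 1 κ x₀ y₀) hG ht k
  have h2 := hasDerivWithinAt_charMild hκ0 abs_neg_one (charData (-1) κ x₀ y₀) hG ht k
  simp only [linWave_apply hκ0 hκ1, linWaveDeriv_apply hκ0 hκ1]
  refine (((h1.sub h2).div_const _).const_mul _).congr_deriv ?_
  ring

/-- The characteristic equation `λ² = -2κλ - |k|²` reassembles the two first-order equations into
the second-order one. -/
theorem hasDerivWithinAt_linWaveDeriv (hκ0 : 0 < κ) (hκ1 : κ < 1) (x₀ y₀ : SeqSpace)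
    {G : ℝ → SeqSpace} (hG : Continuous G) {t : ℝ} (ht : 0 ≤ t) (k : Fin 3 → ℤ) :
    HasDerivWithinAt (fun t => linWaveDeriv κ x₀ y₀ G t k)
      (-2 * κ * linWaveDeriv κ x₀ y₀ G t k -
        freqSq k * (linWave κ x₀ y₀ G t k / (bracket k : ℂ)) + G t k) (Ici 0) t := by
  have h1 := hasDerivWithinAt_charMild hκ0 abs_one (charData 1 κ x₀ y₀) hG ht k
  have h2 := hasDerivWithinAt_charMild hκ0 abs_neg_one (charData (-1) κ x₀ y₀) hG ht k
  simp only [linWave_apply hκ0 hκ1, linWaveDeriv_apply hκ0 hκ1]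
  refine (((h1.const_mul _).sub (h2.const_mul _)).div_const _).congr_deriv ?_
  have hb : (bracket k : ℂ) ≠ 0 := Complex.ofReal_ne_zero.mpr (bracket_pos k).ne'
  have hg := halfGap_ne_zero hκ0 hκ1 k
  have h := charRoot_one_sub (κ := κ) k
  have e1 := charRoot_sq hκ0 hκ1 abs_one k
  have e2 := charRoot_sq hκ0 hκ1 abs_neg_one k
  rw [mul_div_cancel_left₀ _ hb]
  generalize charMild 1 κ (charData 1 κ x₀ y₀) G t k = p at *
  generalize charMild (-1) κ (charData (-1) κ x₀ y₀) G t k = q at *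
  field_simp
  linear_combination p * e1 - q * e2 + G t k * h

/-- Coefficientwise solutions of the damped wave equation are given by `linWave`. -/
theorem eq_linWave (hκ0 : 0 < κ) (hκ1 : κ < 1) (x₀ y₀ : SeqSpace)
    {G : ℝ → SeqSpace} (hG : Continuous G) {k : Fin 3 → ℤ} {y v : ℝ → ℂ}
    (hy : ∀ t, 0 ≤ t → HasDerivWithinAt y (v t) (Ici 0) t)
    (hv : ∀ t, 0 ≤ t → HasDerivWithinAt v (-2 * κ * v t - freqSq k * y t + G t k) (Ici 0) t)
    (hy0 : bracket k * y 0 = x₀ k) (hv0 : v 0 = y₀ k) {t : ℝ} (ht : 0 ≤ t) :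
    bracket k * y t = linWave κ x₀ y₀ G t k := by
  have hGk : Continuous fun s => G s k := (coordL k).continuous.comp hG
  have hb : (bracket k : ℂ) ≠ 0 := Complex.ofReal_ne_zero.mpr (bracket_pos k).ne'
  have hg := halfGap_ne_zero hκ0 hκ1 k
  -- The operator factors as `(∂ₜ - λ_σ)(∂ₜ - λ_{-σ})`, so `v - λ_{-σ} y` solves a scalar
  -- first-order equation and is given by Duhamel.
  have key : ∀ σ : ℝ, |σ| = 1 → v t - charRoot (-σ) κ k * y t =
      charMild σ κ (charData σ κ x₀ y₀) G t k := fun σ hσ => by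
    have hsq := halfGap_sq hκ0 hκ1 k
    have h2 : (σ : ℂ) ^ 2 = 1 := by
      rw [← Complex.ofReal_pow, ← sq_abs, hσ, one_pow, Complex.ofReal_one]
    have hd : ∀ s, 0 ≤ s → HasDerivWithinAt (fun s => v s - charRoot (-σ) κ k * y s)
        (charRoot σ κ k * (v s - charRoot (-σ) κ k * y s) + G s k) (Ici 0) s := fun s hs => by
      refine ((hv s hs).sub ((hy s hs).const_mul _)).congr_deriv ?_
      simp only [charRoot]
      push_cast
      linear_combination (-(σ : ℂ) ^ 2 * y s) * hsq - (κ ^ 2 - freqSq k : ℂ) * y s * h2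
    rw [eq_duhamel_of_hasDerivWithinAt hGk hd ht, charMild_apply hκ0 hσ _ hG ht,
      charData_apply hκ0 hκ1 hσ, hv0, ← hy0]
    congr 2
    field_simp
  rw [linWave_apply hκ0 hκ1, ← key 1 abs_one, ← key (-1) abs_neg_one, neg_neg]
  have h := charRoot_one_sub (κ := κ) k
  field_simp
  linear_combination -y t * h

/-- The kernel of the Duhamel formula for the damped wave equation. -/
noncomputable def waveKernel (κ t : ℝ) : SeqSpace →L[ℝ] SeqSpace :=
  (gapLift κ).comp (waveSemigroup 1 κ t - waveSemigroup (-1) κ t)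

theorem continuous_waveKernel (hκ0 : 0 < κ) :
    Continuous fun p : ℝ × SeqSpace => waveKernel κ p.1 p.2 :=
  (gapLift κ).continuous.comp ((continuous_waveSemigroup hκ0 abs_one).sub
    (continuous_waveSemigroup hκ0 abs_neg_one))

theorem norm_waveKernel_le (hκ0 : 0 < κ) (hκ1 : κ < 1) (t : ℝ) (x : SeqSpace) :
    ‖waveKernel κ t x‖ ≤ 2 * gainConst κ * ‖x‖ := by
  have hg := gainConst_pos hκ0
  refine (norm_gapLift_le hκ0 hκ1 _).trans ?_
  calc gainConst κ * ‖waveSemigroup 1 κ t x - waveSemigroup (-1) κ t x‖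
      ≤ gainConst κ * (‖x‖ + ‖x‖) := by
        gcongr
        exact (norm_sub_le _ _).trans (add_le_add (norm_waveSemigroup_le hκ0 abs_one t x)
          (norm_waveSemigroup_le hκ0 abs_neg_one t x))
    _ = _ := by ring

/-- The solution of the homogeneous damped wave equation. -/
noncomputable def freeWave (κ : ℝ) (x₀ y₀ : SeqSpace) (t : ℝ) : SeqSpace :=
  gapLift κ (waveSemigroup 1 κ t (charData 1 κ x₀ y₀) -
    waveSemigroup (-1) κ t (charData (-1) κ x₀ y₀))

theorem continuous_freeWave (hκ0 : 0 < κ) (x₀ y₀ : SeqSpace) :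
    Continuous (freeWave κ x₀ y₀) :=
  (gapLift κ).continuous.comp
    (((continuous_waveSemigroup hκ0 abs_one).comp
      (f := fun t => (t, charData 1 κ x₀ y₀)) (by fun_prop)).sub
    ((continuous_waveSemigroup hκ0 abs_neg_one).comp
      (f := fun t => (t, charData (-1) κ x₀ y₀)) (by fun_prop)))

theorem norm_freeWave_le (hκ0 : 0 < κ) (hκ1 : κ < 1) (x₀ y₀ : SeqSpace) (t : ℝ) :
    ‖freeWave κ x₀ y₀ t‖ ≤ 2 * gainConst κ * (‖y₀‖ + 2 * ‖x₀‖) := by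
  have hg := gainConst_pos hκ0
  refine (norm_gapLift_le hκ0 hκ1 _).trans ?_
  rw [mul_comm 2, mul_assoc, two_mul]
  gcongr
  exact (norm_sub_le _ _).trans (add_le_add
    ((norm_waveSemigroup_le hκ0 abs_one t _).trans (norm_charData_le hκ0 hκ1 abs_one _ _))
    ((norm_waveSemigroup_le hκ0 abs_neg_one t _).trans
      (norm_charData_le hκ0 hκ1 abs_neg_one _ _)))

/-- Separating data from forcing brings the solution into the form required by the abstract fixed
point and uniqueness results. -/
theorem linWave_eq_freeWave_add (hκ0 : 0 < κ) (x₀ y₀ : SeqSpace)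
    {G : ℝ → SeqSpace} (hG : Continuous G) (t : ℝ) :
    linWave κ x₀ y₀ G t =
      freeWave κ x₀ y₀ t + ∫ s in (0 : ℝ)..t, waveKernel κ (t - s) (G s) := by
  have h1 := waveSemigroup_intervalIntegrable hκ0 abs_one hG t
  have h2 := waveSemigroup_intervalIntegrable hκ0 abs_neg_one hG t
  have h3 : ∫ s in (0 : ℝ)..t, waveKernel κ (t - s) (G s) =
      gapLift κ (∫ s in (0 : ℝ)..t, (waveSemigroup 1 κ (t - s) (G s) -
        waveSemigroup (-1) κ (t - s) (G s))) :=
    (gapLift κ).intervalIntegral_comp_comm (h1.sub h2)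
  rw [h3, intervalIntegral.integral_sub h1 h2, freeWave, linWave, ← map_add, charMild, charMild]
  congr 1
  abel

end LinWave

/-! ### Second-order time regularity in `L²` -/

section TimeDerivs

/-- The Fourier weight `⟨k⟩^{-s}`. -/
noncomputable def bracketMul (s : ℝ) : SeqSpace →L[ℝ] SeqSpace :=
  (diag fun k => ((bracket k ^ (-s) : ℝ) : ℂ)).restrictScalars ℝ

theorem bracketMul_apply {s : ℝ} (hs : 0 ≤ s) (x : SeqSpace) (k : Fin 3 → ℤ) :
    bracketMul s x k = ((bracket k ^ (-s) : ℝ) : ℂ) * x k :=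
  diag_apply (norm_bracket_rpow_neg_le hs) x k

theorem norm_bracketMul_le {s : ℝ} (hs : 0 ≤ s) (x : SeqSpace) : ‖bracketMul s x‖ ≤ ‖x‖ := by
  have := norm_diag_apply_le (norm_bracket_rpow_neg_le hs) x
  rwa [one_mul] at this

/-- The negative Laplacian on weighted coefficients of `Hˢ`, `s ≥ 2`. -/
noncomputable def laplaceMul (s : ℝ) : SeqSpace →L[ℝ] SeqSpace :=
  (diag fun k => ((freqSq k * bracket k ^ (-s) : ℝ) : ℂ)).restrictScalars ℝ

theorem freqSq_le_bracket_sq (k : Fin 3 → ℤ) : freqSq k ≤ bracket k ^ 2 := by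
  rw [← norm_freqVec_sq]
  have := norm_freqVec_le_bracket k
  gcongr

theorem freqSq_nonneg (k : Fin 3 → ℤ) : 0 ≤ freqSq k := by
  rw [← norm_freqVec_sq]
  positivity

theorem laplaceMul_apply {s : ℝ} (hs : 2 ≤ s) (x : SeqSpace) (k : Fin 3 → ℤ) :
    laplaceMul s x k = (freqSq k : ℂ) * (((bracket k ^ (-s) : ℝ) : ℂ) * x k) := by
  have h : ∀ k, ‖((freqSq k * bracket k ^ (-s) : ℝ) : ℂ)‖ ≤ 1 := fun k => by
    have hb := Real.rpow_nonneg (bracket_pos k).le (-s)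
    rw [Complex.norm_real, Real.norm_of_nonneg (mul_nonneg (freqSq_nonneg k) hb)]
    calc freqSq k * bracket k ^ (-s) ≤ bracket k ^ 2 * bracket k ^ (-s) := by
          gcongr
          exact freqSq_le_bracket_sq k
      _ = bracket k ^ (2 - s) := by
          rw [← Real.rpow_natCast, ← Real.rpow_add (bracket_pos k)]
          congr 1
      _ ≤ 1 := Real.rpow_le_one_of_one_le_of_nonpos (one_le_bracket k) (by linarith)
  change diag (fun k => ((freqSq k * bracket k ^ (-s) : ℝ) : ℂ)) x k = _
  rw [diag_apply h]
  push_cast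
  ring

theorem HasTimeDerivs.comp_clm {E F : Type*} [NormedAddCommGroup E] [NormedSpace ℝ E]
    [NormedAddCommGroup F] [NormedSpace ℝ F] {z v w : ℝ → E} (h : HasTimeDerivs z v w)
    (T : E →L[ℝ] F) :
    HasTimeDerivs (fun t => T (z t)) (fun t => T (v t)) (fun t => T (w t)) where
  first t ht := T.hasFDerivAt.comp_hasDerivWithinAt t (h.first t ht)
  second t ht := T.hasFDerivAt.comp_hasDerivWithinAt t (h.second t ht)
  cont := T.continuous.comp_continuousOn h.cont

/-- Removing the weights places everything in `ℓ²`, where the Laplacian is bounded on `H^{m+1}`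
coordinates since `m + 1 ≥ 2`. The derivatives are then continuous curves, so the coefficientwise
computation suffices. -/
theorem linWave_hasTimeDerivs {κ m : ℝ} (hκ0 : 0 < κ) (hκ1 : κ < 1) (hm : 1 ≤ m)
    (x₀ y₀ : SeqSpace) {G : ℝ → SeqSpace} (hG : Continuous G) :
    HasTimeDerivs (fun t => bracketMul (m + 1) (linWave κ x₀ y₀ G t))
      (fun t => bracketMul m (linWaveDeriv κ x₀ y₀ G t))
      (fun t => (-(2 * κ)) • bracketMul m (linWaveDeriv κ x₀ y₀ G t) -
        laplaceMul (m + 1) (linWave κ x₀ y₀ G t) + bracketMul m (G t)) := by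
  have h1 : Continuous fun t => bracketMul m (linWaveDeriv κ x₀ y₀ G t) :=
    (bracketMul m).continuous.comp (continuous_linWaveDeriv hκ0 x₀ y₀ hG)
  have h2 : Continuous fun t => laplaceMul (m + 1) (linWave κ x₀ y₀ G t) :=
    (laplaceMul (m + 1)).continuous.comp (continuous_linWave hκ0 x₀ y₀ hG)
  have h3 : Continuous fun t => (-(2 * κ)) • bracketMul m (linWaveDeriv κ x₀ y₀ G t) -
        laplaceMul (m + 1) (linWave κ x₀ y₀ G t) + bracketMul m (G t) := by fun_prop
  have hb : ∀ k, bracket k ^ (-(m + 1)) * bracket k = bracket k ^ (-m) := fun k => by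
    nth_rewrite 2 [← Real.rpow_one (bracket k)]
    rw [← Real.rpow_add (bracket_pos k)]
    congr 1
    ring
  have hbne : ∀ k, (bracket k : ℂ) ≠ 0 := fun k => Complex.ofReal_ne_zero.mpr (bracket_pos k).ne'
  refine ⟨fun t ht => SeqSpace.hasDerivWithinAt_of_coord h1 (fun k t ht => ?_) ht,
    fun t ht => SeqSpace.hasDerivWithinAt_of_coord h3 (fun k t ht => ?_) ht, h3.continuousOn⟩
  · simp only [bracketMul_apply (show (0 : ℝ) ≤ m + 1 by linarith),
      bracketMul_apply (show (0 : ℝ) ≤ m by linarith)]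
    refine ((hasDerivWithinAt_linWave hκ0 hκ1 x₀ y₀ hG ht k).const_mul _).congr_deriv ?_
    rw [← hb]
    push_cast
    ring
  · simp only [lp.coeFn_add, lp.coeFn_sub, lp.coeFn_smul, Pi.add_apply, Pi.sub_apply,
      Pi.smul_apply, bracketMul_apply (show (0 : ℝ) ≤ m by linarith),
      laplaceMul_apply (show (2 : ℝ) ≤ m + 1 by linarith), Complex.real_smul]
    refine ((hasDerivWithinAt_linWaveDeriv hκ0 hκ1 x₀ y₀ hG ht k).const_mul _).congr_deriv ?_
    rw [← hb]
    have := hbne k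
    push_cast
    field_simp

end TimeDerivs

/-! ### The cubic nonlinearity -/

section Nonlinearity

/-- The constant function `1`, in Fourier coefficients. -/
noncomputable def oneSeq : SeqSpace := lp.single 2 0 1

theorem oneSeq_apply (k : Fin 3 → ℤ) : oneSeq k = if k = 0 then 1 else 0 := by
  rw [oneSeq, lp.single_apply, Pi.single_apply]

theorem norm_oneSeq : ‖oneSeq‖ = 1 := by
  rw [oneSeq, lp.norm_single (by norm_num), norm_one]

theorem coeffs_const (c : ℝ) (k : Fin 3 → ℤ) :
    coeffs (Lp.const 2 torusMeasure c) k = if k = 0 then (c : ℂ) else 0 := by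
  rw [coeffs_apply, fourierCoeff3]
  have h : ∫ x, (∏ j, (fourier (-(k j)) (x j) : ℂ)) *
      ((Lp.const 2 torusMeasure c : L2Torus) x : ℂ) ∂torusMeasure =
      ∫ x, torusChar (-k) x * (c : ℂ) ∂torusMeasure := by
    refine integral_congr_ae ?_
    filter_upwards [Lp.coeFn_const (p := 2) (μ := torusMeasure) c] with x hx
    rw [hx]
    rfl
  rw [h, integral_mul_const, integral_torusChar]
  simp

theorem sobolevCoords_const_one (s : ℝ) :
    MemSobolev s (Lp.const 2 torusMeasure (1 : ℝ)) ∧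
      sobolevCoords s (Lp.const 2 torusMeasure (1 : ℝ)) = oneSeq := by
  refine memSobolev_of_coords _ fun k => ?_
  rw [coeffs_const, oneSeq_apply]
  split_ifs with hk
  · simp [hk, bracket_zero]
  · simp

theorem sobolevCoords_lower {m : ℝ} {u : L2Torus} (hu : MemSobolev (m + 1) u) :
    MemSobolev m u ∧ sobolevCoords m u = bracketMul 1 (sobolevCoords (m + 1) u) := by
  refine memSobolev_of_coords _ fun k => ?_
  rw [bracketMul_apply zero_le_one, sobolevCoords_apply hu, ← mul_assoc, ← Complex.ofReal_mul,
    ← Real.rpow_add (bracket_pos k)]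
  congr 3
  ring

/-- The nonlinearity `a (1 + u)³` in weighted Fourier coefficients. -/
noncomputable def cubicForce (B : SeqSpace →L[ℝ] SeqSpace →L[ℝ] SeqSpace) (A x : SeqSpace) :
    SeqSpace :=
  B A (B (oneSeq + bracketMul 1 x) (B (oneSeq + bracketMul 1 x) (oneSeq + bracketMul 1 x)))

variable {B : SeqSpace →L[ℝ] SeqSpace →L[ℝ] SeqSpace}

theorem continuous_cubicForce {A : ℝ → SeqSpace} (hA : Continuous A) :
    Continuous fun p : ℝ × SeqSpace => cubicForce B (A p.1) p.2 := by
  simp only [cubicForce]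
  fun_prop

theorem norm_oneSeq_add_le {M : ℝ} {x : SeqSpace} (hx : ‖x‖ ≤ M) :
    ‖oneSeq + bracketMul 1 x‖ ≤ 1 + M := by
  refine (norm_add_le _ _).trans ?_
  rw [norm_oneSeq]
  linarith [norm_bracketMul_le zero_le_one x]

theorem norm_cubicForce_le {M S : ℝ} {A x : SeqSpace} (hA : ‖A‖ ≤ S) (hx : ‖x‖ ≤ M) :
    ‖cubicForce B A x‖ ≤ ‖B‖ ^ 3 * S * (1 + M) ^ 3 := by
  have hb := norm_oneSeq_add_le hx
  have hM : 0 ≤ 1 + M := (norm_nonneg _).trans hb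
  have hS : 0 ≤ S := (norm_nonneg _).trans hA
  rw [cubicForce]
  set b := oneSeq + bracketMul 1 x
  calc ‖B A (B b (B b b))‖ ≤ ‖B‖ * ‖A‖ * (‖B‖ * ‖b‖ * (‖B‖ * ‖b‖ * ‖b‖)) := by
        refine (B.le_opNorm₂ _ _).trans ?_
        gcongr
        refine (B.le_opNorm₂ _ _).trans ?_
        gcongr
        exact B.le_opNorm₂ _ _
    _ ≤ ‖B‖ * S * (‖B‖ * (1 + M) * (‖B‖ * (1 + M) * (1 + M))) := by gcongr
    _ = _ := by ring

theorem norm_cubicForce_sub_le {M S : ℝ} {A x y : SeqSpace} (hA : ‖A‖ ≤ S) (hx : ‖x‖ ≤ M)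
    (hy : ‖y‖ ≤ M) :
    ‖cubicForce B A x - cubicForce B A y‖ ≤ 3 * ‖B‖ ^ 3 * S * (1 + M) ^ 2 * ‖x - y‖ := by
  have hb := norm_oneSeq_add_le hx
  have hc := norm_oneSeq_add_le hy
  have hM : 0 ≤ 1 + M := (norm_nonneg _).trans hb
  have hS : 0 ≤ S := (norm_nonneg _).trans hA
  have hd : ‖(oneSeq + bracketMul 1 x) - (oneSeq + bracketMul 1 y)‖ ≤ ‖x - y‖ := by
    rw [add_sub_add_left_eq_sub, ← map_sub]
    exact norm_bracketMul_le zero_le_one _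
  rw [cubicForce, cubicForce]
  set b := oneSeq + bracketMul 1 x
  set c := oneSeq + bracketMul 1 y
  -- Telescoping of `b³ - c³`, one factor at a time, using only bilinearity of `B`.
  have h : B A (B b (B b b)) - B A (B c (B c c)) =
      B A (B (b - c) (B b b) + B c (B (b - c) b) + B c (B c (b - c))) := by
    simp only [map_sub, map_add, _root_.sub_apply]
    abel
  rw [h]
  have hB2 : ∀ x y z : SeqSpace, ‖B x (B y z)‖ ≤ ‖B‖ * ‖x‖ * (‖B‖ * ‖y‖ * ‖z‖) :=
    fun x y z => by
      refine (B.le_opNorm₂ _ _).trans ?_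
      gcongr
      exact B.le_opNorm₂ _ _
  calc ‖B A (B (b - c) (B b b) + B c (B (b - c) b) + B c (B c (b - c)))‖
      ≤ ‖B‖ * ‖A‖ * (‖B‖ * ‖b - c‖ * (‖B‖ * ‖b‖ * ‖b‖) + ‖B‖ * ‖c‖ * (‖B‖ * ‖b - c‖ * ‖b‖) +
          ‖B‖ * ‖c‖ * (‖B‖ * ‖c‖ * ‖b - c‖)) := by
        refine (B.le_opNorm₂ _ _).trans ?_
        gcongr
        exact (norm_add₃_le).trans (add_le_add (add_le_add (hB2 _ _ _) (hB2 _ _ _)) (hB2 _ _ _))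
    _ ≤ ‖B‖ * S * (‖B‖ * ‖x - y‖ * (‖B‖ * (1 + M) * (1 + M)) +
          ‖B‖ * (1 + M) * (‖B‖ * ‖x - y‖ * (1 + M)) +
          ‖B‖ * (1 + M) * (‖B‖ * (1 + M) * ‖x - y‖)) := by gcongr
    _ = _ := by ring

theorem exists_cubicForce {m : ℝ} (hm : 3 / 2 < m)
    (hB : ∀ x y k, B x y k = convCoeff m x y k) {a u : L2Torus} (ha : MemSobolev m a)
    (hu : MemSobolev (m + 1) u) :
    ∃ p : L2Torus, MemSobolev m p ∧ (∀ᵐ x ∂torusMeasure, p x = a x * (1 + u x) ^ 3) ∧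
      sobolevCoords m p = cubicForce B (sobolevCoords m a) (sobolevCoords (m + 1) u) := by
  obtain ⟨hu1, hu2⟩ := sobolevCoords_lower hu
  obtain ⟨h11, h12⟩ := sobolevCoords_const_one m
  obtain ⟨hb, hb2⟩ := sobolevCoords_add h11 hu1
  rw [h12, hu2] at hb2
  obtain ⟨q, hq1, hq2, hq3⟩ := exists_mul_memSobolev hm hB hb hb
  obtain ⟨r, hr1, hr2, hr3⟩ := exists_mul_memSobolev hm hB hb hq1
  obtain ⟨p, hp1, hp2, hp3⟩ := exists_mul_memSobolev hm hB ha hr1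
  refine ⟨p, hp1, ?_, by rw [hp3, hr3, hq3, hb2, cubicForce]⟩
  filter_upwards [hq2, hr2, hp2, Lp.coeFn_add (Lp.const 2 torusMeasure (1 : ℝ)) u,
    Lp.coeFn_const (p := 2) (μ := torusMeasure) (1 : ℝ)] with x h1 h2 h3 h4 h5
  rw [h3, h2, h1, h4, Pi.add_apply, h5, Function.const_apply]
  ring

end Nonlinearity

/-! ### Equivalence of strong and mild solutions, and uniqueness -/

section Solutions

/-- Values at negative times are arbitrary; the clamp `max t 0` gives a curve continuous on all of
`ℝ`. -/
theorem continuous_sobolevCoords {s : ℝ} {a : ℝ → L2Torus} (ha : ContSobolev s a) :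
    Continuous fun t => sobolevCoords s (a (max t 0)) := by
  have h1 : ContinuousOn (fun t => sobolevCoords s (a t)) (Ici 0) := fun t ht => by
    rw [ContinuousWithinAt, tendsto_iff_norm_sub_tendsto_zero]
    refine (ha.2 t ht).congr' ?_
    filter_upwards [self_mem_nhdsWithin] with r hr
    obtain ⟨h1, h2⟩ := sobolevCoords_sub (ha.1 r hr) (ha.1 t ht)
    rw [sobolevNorm_eq h1, h2]
  exact h1.comp_continuous (by fun_prop) fun t => le_max_right t 0

/-- The forcing term of the wave equation along a curve `u`, in weighted coefficients. -/
noncomputable def waveForce (B : SeqSpace →L[ℝ] SeqSpace →L[ℝ] SeqSpace) (κ m : ℝ)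
    (a : ℝ → L2Torus) (U : ℝ → SeqSpace) (t : ℝ) : SeqSpace :=
  exp (-κ * t) • cubicForce B (sobolevCoords m (a (max t 0))) (U t)

variable {κ m : ℝ} {B : SeqSpace →L[ℝ] SeqSpace →L[ℝ] SeqSpace} {a : ℝ → L2Torus}
  {f g : L2Torus}

theorem continuous_waveForce (ha : ContSobolev m a) {U : ℝ → SeqSpace} (hU : Continuous U) :
    Continuous (waveForce B κ m a U) := by
  have := (continuous_cubicForce (B := B) (continuous_sobolevCoords ha)).comp
    (f := fun t => (t, U t)) (by fun_prop)
  simp only [Function.comp_def] at this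
  unfold waveForce
  fun_prop

/-- The equation satisfied almost everywhere, as an identity in `L²`. -/
theorem ae_wave_equation_iff {w v h p : L2Torus} {c e : ℝ} {F : Torus3 → ℝ}
    (hp : ∀ᵐ x ∂torusMeasure, p x = F x) :
    (∀ᵐ x ∂torusMeasure, w x + 2 * c * v x - h x = e * F x) ↔
      w + (2 * c) • v - h = e • p := by
  rw [Lp.ext_iff]
  have h1 := Lp.coeFn_sub (w + (2 * c) • v) h
  have h2 := Lp.coeFn_add w ((2 * c) • v)
  have h3 := Lp.coeFn_smul (2 * c) v
  have h4 := Lp.coeFn_smul e p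
  constructor
  · intro H
    filter_upwards [hp, h1, h2, h3, h4, H] with x hp h1 h2 h3 h4 H
    simp only [h1, h2, h3, h4, Pi.sub_apply, Pi.add_apply, Pi.smul_apply, smul_eq_mul, hp, H]
  · intro H
    filter_upwards [hp, h1, h2, h3, h4, H] with x hp h1 h2 h3 h4 H
    simpa only [h1, h2, h3, h4, Pi.sub_apply, Pi.add_apply, Pi.smul_apply, smul_eq_mul, hp] using H

/-- Every solution of the wave equation satisfies the Duhamel formula. -/
theorem IsWaveSolution.eq_linWave (hκ0 : 0 < κ) (hκ1 : κ < 1) (hm : 3 / 2 < m)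
    (hB : ∀ x y k, B x y k = convCoeff m x y k)
    (hg : MemSobolev m g) (ha : ContSobolev m a) {u : ℝ → L2Torus}
    (hu : IsWaveSolution κ m a f g u) {t : ℝ} (ht : 0 ≤ t) :
    sobolevCoords (m + 1) (u t) = linWave κ (sobolevCoords (m + 1) f) (sobolevCoords m g)
      (waveForce B κ m a fun s => sobolevCoords (m + 1) (u (max s 0))) t := by
  obtain ⟨huc, v, w, hd, hu0, hv0, heq⟩ := hu
  have hG := continuous_waveForce (B := B) (κ := κ) ha (continuous_sobolevCoords huc)
  refine SeqSpace.ext fun k => ?_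
  -- The `k`-th coefficient with weight `⟨k⟩ᵐ` is a bounded functional on `L²`, so it turns the
  -- equation into a scalar second-order ODE.
  let T : L2Torus →L[ℝ] ℂ := ((bracket k ^ m : ℝ) : ℂ) • (coordL k).comp coeffs
  have hT : ∀ z, T z = ((bracket k ^ m : ℝ) : ℂ) * coeffs z k := fun z => rfl
  have hbm : (bracket k : ℂ) * ((bracket k ^ m : ℝ) : ℂ) = ((bracket k ^ (m + 1) : ℝ) : ℂ) := by
    rw [← Complex.ofReal_mul, Real.rpow_add (bracket_pos k), Real.rpow_one, mul_comm]
  have h1 : ∀ s, 0 ≤ s → sobolevCoords (m + 1) (u s) k = bracket k * T (u s) := fun s hs => by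
    rw [hT, ← mul_assoc, hbm, sobolevCoords_apply (huc.1 s hs)]
  have hdT := hd.comp_clm T
  rw [h1 t ht]
  refine _root_.eq_linWave hκ0 hκ1 _ _ hG (y := fun t => T (u t)) (v := fun t => T (v t))
    hdT.first (fun s hs => ?_) ?_ ?_ ht
  · refine (hdT.second s hs).congr_deriv ?_
    obtain ⟨h, hh, hae⟩ := heq s hs
    obtain ⟨p, hp1, hp2, hp3⟩ := exists_cubicForce hm hB (ha.1 s hs) (huc.1 s hs)
    rw [ae_wave_equation_iff hp2] at hae
    have hw : w s = exp (-κ * s) • p - (2 * κ) • v s + h := by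
      rw [← hae]
      abel
    have hTh : T h = -freqSq k * T (u s) := by
      have := hh k
      rw [← coeffs_apply, ← coeffs_apply] at this
      rw [hT, hT, this]
      ring
    have hTp : T p = cubicForce B (sobolevCoords m (a s)) (sobolevCoords (m + 1) (u s)) k := by
      rw [← hp3, sobolevCoords_apply hp1, hT]
    rw [hw, map_add, map_sub, map_smul, map_smul, hTh, hTp, waveForce, max_eq_left hs,
      lp.coeFn_smul, Pi.smul_apply, Complex.real_smul, Complex.real_smul]
    push_cast
    ring
  · rw [← h1 0 le_rfl, hu0]
  · rw [hv0, hT, sobolevCoords_apply hg]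

theorem bracketMul_sobolevCoords {s : ℝ} (hs : 0 ≤ s) {u : L2Torus} (hu : MemSobolev s u) :
    bracketMul s (sobolevCoords s u) = coeffs u :=
  SeqSpace.ext fun k => by rw [bracketMul_apply hs, coeffs_eq_of_memSobolev hu]

/-- The weight is real and even in `k`, so it commutes with the projection onto Hermitian sequences.
-/
theorem coeffs_synth_bracketMul {s : ℝ} (hs : 0 ≤ s) (x : SeqSpace) (k : Fin 3 → ℤ) :
    coeffs (synth (bracketMul s x)) k =
      ((bracket k ^ (-s) : ℝ) : ℂ) * coeffs (synth x) k := by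
  rw [coeffs_synth, coeffs_synth, bracketMul_apply hs, bracketMul_apply hs, bracket_neg, map_mul,
    Complex.conj_ofReal]
  ring

theorem sobolevCoords_synth {s : ℝ} (hs : 0 ≤ s) (x : SeqSpace) :
    MemSobolev s (synth (bracketMul s x)) ∧
      sobolevCoords s (synth (bracketMul s x)) = coeffs (synth x) := by
  refine memSobolev_of_coords _ fun k => ?_
  rw [coeffs_synth_bracketMul hs, ← mul_assoc, ← Complex.ofReal_mul, bracket_rpow_neg,
    Complex.ofReal_one, one_mul]

/-- Solutions of the (symmetrized) Duhamel equation yield solutions of the wave equation. -/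
theorem isWaveSolution_of_linWave (hκ0 : 0 < κ) (hκ1 : κ < 1) (hm : 3 / 2 < m)
    (hB : ∀ x y k, B x y k = convCoeff m x y k) (hf : MemSobolev (m + 1) f)
    (hg : MemSobolev m g) (ha : ContSobolev m a) {U : ℝ → SeqSpace} (hU : Continuous U)
    (hUe : ∀ t, 0 ≤ t → U t = coeffs (synth (linWave κ (sobolevCoords (m + 1) f)
      (sobolevCoords m g) (waveForce B κ m a U) t))) :
    ∃ u : ℝ → L2Torus, IsWaveSolution κ m a f g u ∧
      ∀ t, 0 ≤ t → sobolevCoords (m + 1) (u t) = U t := by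
  have hG := continuous_waveForce (B := B) (κ := κ) ha hU
  set x₀ := sobolevCoords (m + 1) f
  set y₀ := sobolevCoords m g
  set G := waveForce B κ m a U
  have hm0 : 0 ≤ m := by linarith
  have hm1 : 0 ≤ m + 1 := by linarith
  have hmem : ∀ t, 0 ≤ t → MemSobolev (m + 1) (synth (bracketMul (m + 1) (linWave κ x₀ y₀ G t))) ∧
      sobolevCoords (m + 1) (synth (bracketMul (m + 1) (linWave κ x₀ y₀ G t))) = U t :=
    fun t ht => by
      rw [hUe t ht]
      exact sobolevCoords_synth hm1 _
  refine ⟨fun t => synth (bracketMul (m + 1) (linWave κ x₀ y₀ G t)),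
    ⟨⟨fun t ht => (hmem t ht).1, fun t ht => ?_⟩, _, _,
      (linWave_hasTimeDerivs hκ0 hκ1 (by linarith) x₀ y₀ hG).comp_clm synth, ?_, ?_,
      fun t ht => ?_⟩, fun t ht => (hmem t ht).2⟩
  · have h1 : Tendsto (fun r => ‖U r - U t‖) (𝓝[Ici 0] t) (𝓝 0) := by
      rw [← tendsto_iff_norm_sub_tendsto_zero]
      exact hU.continuousWithinAt
    refine h1.congr' ?_
    filter_upwards [self_mem_nhdsWithin] with r hr
    obtain ⟨h2, h3⟩ := sobolevCoords_sub (hmem r hr).1 (hmem t ht).1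
    rw [sobolevNorm_eq h2, h3, (hmem r hr).2, (hmem t ht).2]
  · simp only
    rw [linWave_zero hκ0 hκ1 _ _ hG, bracketMul_sobolevCoords hm1 hf, synth_coeffs]
  · rw [linWaveDeriv_zero hκ0 hκ1 _ _ hG, bracketMul_sobolevCoords hm0 hg, synth_coeffs]
  · refine ⟨-synth (laplaceMul (m + 1) (linWave κ x₀ y₀ G t)), fun k => ?_, ?_⟩
    · rw [← coeffs_apply, ← coeffs_apply, map_neg, lp.coeFn_neg, Pi.neg_apply, coeffs_synth,
        coeffs_synth_bracketMul hm1, coeffs_synth, laplaceMul_apply (by linarith),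
        laplaceMul_apply (by linarith), bracket_neg, freqSq_neg, map_mul, map_mul,
        Complex.conj_ofReal, Complex.conj_ofReal]
      ring
    · obtain ⟨p, hp1, hp2, hp3⟩ := exists_cubicForce hm hB (ha.1 t ht) (hmem t ht).1
      -- At `U t`, the coordinates of a real function, the force is the real function `p`, so
      -- `synth` loses nothing.
      have hpG : exp (-κ * t) • p = synth (bracketMul m (G t)) := by
        rw [← synth_coeffs p, ← bracketMul_sobolevCoords hm0 hp1, hp3, (hmem t ht).2]
        simp only [G, waveForce]
        rw [max_eq_left ht, map_smul, map_smul]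
      rw [ae_wave_equation_iff hp2, hpG, map_add, map_sub, map_smul]
      simp only [neg_smul]
      abel

/-- Uniqueness of solutions of the wave equation. -/
theorem IsWaveSolution.unique (hκ0 : 0 < κ) (hκ1 : κ < 1) (hm : 3 / 2 < m)
    (hB : ∀ x y k, B x y k = convCoeff m x y k)
    (hg : MemSobolev m g) (ha : ContSobolev m a) {S : ℝ}
    (hS : ∀ t, ‖sobolevCoords m (a (max t 0))‖ ≤ S) {u u' : ℝ → L2Torus}
    (hu : IsWaveSolution κ m a f g u) (hu' : IsWaveSolution κ m a f g u') :
    EqOn u' u (Ici 0) := by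
  intro T hT
  have hS0 : 0 ≤ S := (norm_nonneg _).trans (hS 0)
  have key : ∀ {u : ℝ → L2Torus}, IsWaveSolution κ m a f g u → ∀ t, 0 ≤ t →
      sobolevCoords (m + 1) (u (max t 0)) =
        freeWave κ (sobolevCoords (m + 1) f) (sobolevCoords m g) t +
        ∫ s in (0 : ℝ)..t, waveKernel κ (t - s) (exp (-κ * s) •
          cubicForce B (sobolevCoords m (a (max s 0))) (sobolevCoords (m + 1) (u (max s 0)))) :=
    fun {u} hu t ht => by
      have h := hu.eq_linWave hκ0 hκ1 hm hB hg ha ht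
      rw [linWave_eq_freeWave_add hκ0 _ _
        (continuous_waveForce ha (continuous_sobolevCoords hu.1))] at h
      rw [max_eq_left ht]
      exact h
  have h := mild_solution_unique (S := waveKernel κ)
    (L := freeWave κ (sobolevCoords (m + 1) f) (sobolevCoords m g))
    (N := fun t x => cubicForce B (sobolevCoords m (a (max t 0))) x)
    (U := fun t => sobolevCoords (m + 1) (u' (max t 0)))
    (V := fun t => sobolevCoords (m + 1) (u (max t 0))) hκ0
    (mul_nonneg zero_le_two (gainConst_pos hκ0).le)
    (continuous_waveKernel hκ0) (norm_waveKernel_le hκ0 hκ1)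
    (continuous_cubicForce (B := B) (continuous_sobolevCoords ha))
    (fun M => ⟨3 * ‖B‖ ^ 3 * S * (1 + M) ^ 2, by positivity, fun t x y hx hy =>
      norm_cubicForce_sub_le (hS t) hx hy⟩)
    (continuous_sobolevCoords hu'.1) (continuous_sobolevCoords hu.1) (key hu') (key hu) hT
  simp only [max_eq_left (mem_Ici.mp hT)] at h
  refine coeffs_injective (SeqSpace.ext fun k => ?_)
  rw [coeffs_eq_of_memSobolev (hu'.1.1 T hT), coeffs_eq_of_memSobolev (hu.1.1 T hT), h]

end Solutions

/-! ### Convergence as `t → ∞` -/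

section Asymptotics

variable {κ : ℝ}

theorem tendsto_exp_mul_add_mul (hκ0 : 0 < κ) (b K : ℝ) :
    Tendsto (fun t : ℝ => exp (-κ * t) * (b + t * K)) atTop (𝓝 0) := by
  have h1 := tendsto_rpow_mul_exp_neg_mul_atTop_nhds_zero 1 κ hκ0
  have h0 := tendsto_rpow_mul_exp_neg_mul_atTop_nhds_zero 0 κ hκ0
  have h := (h0.const_mul b).add (h1.const_mul K)
  simp only [mul_zero, add_zero] at h
  refine h.congr fun t => ?_
  simp only [Real.rpow_one, Real.rpow_zero]
  ring

/-- A mild solution of a linear equation whose propagator and forcing decay at the same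
exponential rate tends to zero. -/
theorem tendsto_mild_zero {E : Type*} [NormedAddCommGroup E] [NormedSpace ℝ E] (hκ0 : 0 < κ)
    {S : ℝ → E →L[ℝ] E} (hSb : ∀ t x, 0 ≤ t → ‖S t x‖ ≤ exp (-κ * t) * ‖x‖) (p₀ : E)
    {N : ℝ → E} {K : ℝ} (hN : ∀ s, 0 ≤ s → ‖N s‖ ≤ K) :
    Tendsto (fun t => S t p₀ + ∫ s in (0 : ℝ)..t, S (t - s) (exp (-κ * s) • N s)) atTop (𝓝 0) := by
  refine squeeze_zero_norm' ?_ (tendsto_exp_mul_add_mul hκ0 ‖p₀‖ K)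
  filter_upwards [eventually_ge_atTop 0] with t ht
  rw [mul_add]
  refine (norm_add_le _ _).trans (add_le_add (hSb t p₀ ht) ?_)
  -- Since `e^{-κ(t-s)} e^{-κs} = e^{-κt}`, the integrand is bounded by a constant in `s`; the
  -- integral is at most `t K e^{-κt}`.
  have h1 : ‖∫ s in (0 : ℝ)..t, S (t - s) (exp (-κ * s) • N s)‖ ≤ exp (-κ * t) * K * |t - 0| := by
    refine intervalIntegral.norm_integral_le_of_norm_le_const fun s hs => ?_
    rw [uIoc_of_le ht] at hs
    refine (hSb _ _ (sub_nonneg.mpr hs.2)).trans ?_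
    rw [norm_smul, Real.norm_of_nonneg (Real.exp_pos _).le, ← mul_assoc, ← Real.exp_add]
    have : -κ * (t - s) + -κ * s = -κ * t := by ring
    rw [this]
    gcongr
    exact hN s hs.1.le
  rw [sub_zero, abs_of_nonneg ht] at h1
  linarith

/-- The projection to the zero mode. -/
noncomputable def zeroMode : SeqSpace →L[ℝ] SeqSpace :=
  (diag fun k => if k = 0 then 1 else 0).restrictScalars ℝ

theorem zeroMode_symbol_le (k : Fin 3 → ℤ) : ‖(if k = 0 then 1 else 0 : ℂ)‖ ≤ 1 := by
  split_ifs <;> simp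

theorem zeroMode_apply (x : SeqSpace) (k : Fin 3 → ℤ) :
    zeroMode x k = (if k = 0 then 1 else 0) * x k :=
  diag_apply zeroMode_symbol_le x k

theorem norm_zeroMode_le (x : SeqSpace) : ‖zeroMode x‖ ≤ ‖x‖ := by
  have := norm_diag_apply_le zeroMode_symbol_le x
  rwa [one_mul] at this

theorem norm_waveSemigroup_neg_one_le (hκ0 : 0 < κ) {t : ℝ} (ht : 0 ≤ t) (x : SeqSpace) :
    ‖waveSemigroup (-1) κ t x‖ ≤ exp (-κ * t) * ‖x‖ := by
  refine (norm_diag_apply_le (norm_exp_charRoot_neg_one_le hκ0 t) x).trans_eq ?_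
  rw [max_eq_left ht]

/-- At `k = 0` the root `λ₊` is `0` and the propagator is the identity there; removing it leaves
only roots of real part `-κ`. -/
theorem norm_waveSemigroup_sub_zeroMode_le (hκ0 : 0 < κ) {t : ℝ} (ht : 0 ≤ t) (x : SeqSpace) :
    ‖(waveSemigroup 1 κ t - zeroMode) x‖ ≤ exp (-κ * t) * ‖x‖ := by
  refine SeqSpace.norm_le_of_bound (Real.exp_pos _).le fun k => ?_
  rw [_root_.sub_apply, lp.coeFn_sub, Pi.sub_apply, waveSemigroup_apply hκ0 abs_one,
    zeroMode_apply]
  by_cases hk : k = 0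
  · rw [hk, charRoot_zero]
    simp only [one_mul, neg_add_cancel, Complex.ofReal_zero, zero_mul, Complex.exp_zero,
      if_true, sub_self, norm_zero]
    positivity
  · rw [if_neg hk, zero_mul, sub_zero, norm_mul]
    have := norm_exp_charRoot_le_of_ne_zero (κ := κ) (σ := 1) t hk
    rw [max_eq_left ht] at this ⊢
    gcongr

theorem zeroMode_charData (hκ0 : 0 < κ) (hκ1 : κ < 1) {x₀ y₀ : SeqSpace} (hx : x₀ 0 = 0)
    (hy : y₀ 0 = 0) : zeroMode (charData 1 κ x₀ y₀) = 0 :=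
  SeqSpace.ext fun k => by
    rw [zeroMode_apply, charData_apply hκ0 hκ1 abs_one]
    by_cases hk : k = 0
    · simp [hk, hx, hy]
    · simp [hk]

/-- Only the zero mode of `p₊` survives. With mean-zero data it is `∫₀ᵗ e^{-κs} N̂₀(s) ds`, which
converges to a limit of norm at most `K/κ`; `p₋` and the rest of `p₊` tend to zero. -/
theorem exists_tendsto_linWave (hκ0 : 0 < κ) (hκ1 : κ < 1) {x₀ y₀ : SeqSpace} (hx : x₀ 0 = 0)
    (hy : y₀ 0 = 0) {N : ℝ → SeqSpace} (hN : Continuous N) {K : ℝ}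
    (hK : ∀ s, 0 ≤ s → ‖N s‖ ≤ K) :
    ∃ z : SeqSpace, ‖z‖ ≤ gainConst κ * (K / κ) ∧
      Tendsto (linWave κ x₀ y₀ fun s => exp (-κ * s) • N s) atTop (𝓝 z) := by
  have hK0 : 0 ≤ K := (norm_nonneg _).trans (hK 0 le_rfl)
  have hG : Continuous fun s => exp (-κ * s) • N s := by fun_prop
  have hm := tendsto_mild_zero hκ0 (S := waveSemigroup (-1) κ)
    (fun t x ht => norm_waveSemigroup_neg_one_le hκ0 ht x) (charData (-1) κ x₀ y₀) hK
  have hp := tendsto_mild_zero hκ0 (S := fun t => waveSemigroup 1 κ t - zeroMode)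
    (fun t x ht => norm_waveSemigroup_sub_zeroMode_le hκ0 ht x) (charData 1 κ x₀ y₀) hK
  have hb : ∀ s, 0 ≤ s → ‖zeroMode (exp (-κ * s) • N s)‖ ≤ K * exp (-κ * s) := fun s hs => by
    refine (norm_zeroMode_le _).trans ?_
    rw [norm_smul, Real.norm_of_nonneg (Real.exp_pos _).le, mul_comm]
    gcongr
    exact hK s hs
  have hi : IntegrableOn (fun s => zeroMode (exp (-κ * s) • N s)) (Ioi 0) := by
    refine Integrable.mono' ((exp_neg_integrableOn_Ioi 0 hκ0).const_mul K)
      (zeroMode.continuous.comp hG).aestronglyMeasurable ?_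
    filter_upwards [ae_restrict_mem measurableSet_Ioi] with s hs
    exact hb s (le_of_lt hs)
  have hz := intervalIntegral_tendsto_integral_Ioi 0 hi tendsto_id
  simp only [id] at hz
  set ζ := ∫ s in Ioi (0 : ℝ), zeroMode (exp (-κ * s) • N s)
  have hζ : ‖ζ‖ ≤ K / κ := by
    refine le_of_tendsto hz.norm ?_
    filter_upwards [eventually_ge_atTop 0] with t ht
    have h1 : ‖∫ s in (0 : ℝ)..t, zeroMode (exp (-κ * s) • N s)‖ ≤
        ∫ s in (0 : ℝ)..t, K * exp (-κ * s) :=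
      intervalIntegral.norm_integral_le_of_norm_le ht
        (Eventually.of_forall fun s hs => hb s hs.1.le)
        (Continuous.intervalIntegrable (by fun_prop) _ _)
    refine h1.trans ?_
    rw [intervalIntegral.integral_const_mul, div_eq_mul_one_div]
    gcongr
    exact integral_exp_neg_le hκ0 t
  refine ⟨gapLift κ ζ, (norm_gapLift_le hκ0 hκ1 ζ).trans (by
    have := gainConst_pos hκ0
    gcongr), ?_⟩
  have h2 : Tendsto (charMild 1 κ (charData 1 κ x₀ y₀) fun s => exp (-κ * s) • N s) atTop
      (𝓝 ζ) := by
    have h3 := hp.add hz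
    rw [zero_add] at h3
    refine h3.congr fun t => ?_
    have h4 := waveSemigroup_intervalIntegrable hκ0 abs_one hG t
    have h5 : IntervalIntegrable (fun s => zeroMode (exp (-κ * s) • N s)) volume 0 t :=
      (zeroMode.continuous.comp hG).intervalIntegrable _ _
    simp only [_root_.sub_apply]
    rw [intervalIntegral.integral_sub h4 h5, zeroMode_charData hκ0 hκ1 hx hy, charMild]
    abel
  have h6 := (gapLift κ).continuous.continuousAt.tendsto.comp (h2.sub hm)
  rw [sub_zero] at h6
  exact h6

end Asymptotics

/-! ### Projection onto the mean and the projected system -/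

section MeanValue

theorem meanPart_eq_coeff (u : L2Torus) : (meanPart u : ℂ) = coeffs u 0 := by
  rw [coeffs_apply, fourierCoeff3, meanPart, ← integral_complex_ofReal]
  simp

/-- The mean value as a continuous linear functional. -/
noncomputable def meanL : L2Torus →L[ℝ] ℝ :=
  Complex.reCLM.comp ((coordL 0).comp coeffs)

theorem meanL_apply (u : L2Torus) : meanL u = meanPart u := by
  change (coeffs u 0).re = _
  rw [← meanPart_eq_coeff, Complex.ofReal_re]

/-- The projection to functions of mean zero as a continuous linear map. -/
noncomputable def homL : L2Torus →L[ℝ] L2Torus :=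
  ContinuousLinearMap.id ℝ L2Torus - (Lp.constL 2 torusMeasure ℝ).comp meanL

theorem homL_apply (u : L2Torus) : homL u = homPart u := by
  change u - Lp.const 2 torusMeasure (meanL u) = _
  rw [meanL_apply, homPart]

theorem coeffs_homPart (u : L2Torus) {k : Fin 3 → ℤ} (hk : k ≠ 0) :
    coeffs (homPart u) k = coeffs u k := by
  rw [homPart, map_sub, lp.coeFn_sub, Pi.sub_apply, coeffs_const, if_neg hk, sub_zero]

/-- Removing the mean changes only the coefficient at `k = 0`, which the Laplacian annihilates. -/
theorem isLaplacian_homPart_iff (u h : L2Torus) : IsLaplacian (homPart u) h ↔ IsLaplacian u h := by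
  refine forall_congr' fun k => ?_
  rw [← coeffs_apply, ← coeffs_apply, ← coeffs_apply]
  by_cases hk : k = 0
  · simp [hk, freqSq_zero]
  · rw [coeffs_homPart u hk]

theorem IsLaplacian.meanPart_eq_zero {u h : L2Torus} (H : IsLaplacian u h) : meanPart h = 0 := by
  have := H 0
  rw [← coeffs_apply, ← meanPart_eq_coeff, freqSq_zero] at this
  simpa using this

theorem coeFn_homPart (u : L2Torus) :
    ∀ᵐ x ∂torusMeasure, homPart u x = u x - meanPart u := by
  filter_upwards [Lp.coeFn_sub u (Lp.const 2 torusMeasure (meanPart u)),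
    Lp.coeFn_const (p := 2) (μ := torusMeasure) (meanPart u)] with x h1 h2
  rw [homPart, h1, Pi.sub_apply, h2, Function.const_apply]

theorem const_meanPart_add_homPart (u : L2Torus) :
    Lp.const 2 torusMeasure (meanPart u) + homPart u = u := by
  rw [homPart, add_sub_cancel]

theorem integrable_L2Torus (u : L2Torus) : Integrable u torusMeasure :=
  (Lp.memLp u).integrable (by norm_num)

theorem HasTimeDerivs.add {E : Type*} [NormedAddCommGroup E] [NormedSpace ℝ E]
    {z v w z' v' w' : ℝ → E} (h : HasTimeDerivs z v w) (h' : HasTimeDerivs z' v' w') :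
    HasTimeDerivs (fun t => z t + z' t) (fun t => v t + v' t) (fun t => w t + w' t) where
  first t ht := (h.first t ht).add (h'.first t ht)
  second t ht := (h.second t ht).add (h'.second t ht)
  cont := h.cont.add h'.cont

/-- The mean and its complement are bounded linear projections on `L²`, so they commute with time
derivatives; integrating the wave equation gives the equation for the mean, and the rest follows by
adding or subtracting it. -/
theorem isProjectedSolution_iff (κ m : ℝ) (a : ℝ → L2Torus) (f g : L2Torus) (u : ℝ → L2Torus) :
    IsProjectedSolution κ m a f g u ↔ IsWaveSolution κ m a f g u := by
  constructor
  · rintro ⟨hc, ⟨p, q, hpd, hp0, hp1, hpe⟩, v, w, hd, hv0, hv1, heq⟩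
    have hd' := (hpd.comp_clm (Lp.constL 2 torusMeasure ℝ : ℝ →L[ℝ] L2Torus)).add hd
    have hu : (fun t => (Lp.constL 2 torusMeasure ℝ : ℝ →L[ℝ] L2Torus) (meanPart (u t)) +
        homPart (u t)) = u := funext fun t => const_meanPart_add_homPart (u t)
    rw [hu] at hd'
    refine ⟨hc, _, _, hd', ?_, ?_, fun t ht => ?_⟩
    · rw [← const_meanPart_add_homPart (u 0), hp0, hv0, const_meanPart_add_homPart]
    · rw [hp1, hv1]
      exact const_meanPart_add_homPart g
    · obtain ⟨h, hh, hae⟩ := heq t ht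
      refine ⟨h, (isLaplacian_homPart_iff _ _).mp hh, ?_⟩
      have hm := hpe t ht
      filter_upwards [hae, Lp.coeFn_add (Lp.const 2 torusMeasure (p t)) (v t),
        Lp.coeFn_add (Lp.const 2 torusMeasure (q t)) (w t),
        Lp.coeFn_const (p := 2) (μ := torusMeasure) (p t),
        Lp.coeFn_const (p := 2) (μ := torusMeasure) (q t)] with x h1 h2 h3 h4 h5
      change (Lp.const 2 torusMeasure (q t) + w t : L2Torus) x +
        2 * κ * (Lp.const 2 torusMeasure (p t) + v t : L2Torus) x - h x = _
      rw [h2, h3, Pi.add_apply, Pi.add_apply, h4, h5, Function.const_apply, Function.const_apply]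
      linear_combination h1 + hm
  · rintro ⟨hc, v, w, hd, hu0, hv0, heq⟩
    have hmean : ∀ t, 0 ≤ t → meanPart (w t) + 2 * κ * meanPart (v t) =
        exp (-κ * t) * meanForce (a t) (u t) := fun t ht => by
      obtain ⟨h, hh, hae⟩ := heq t ht
      have h1 := integral_congr_ae hae
      have hw := integrable_L2Torus (w t)
      have hv := (integrable_L2Torus (v t)).const_mul (2 * κ)
      have hwv : Integrable (fun x => w t x + 2 * κ * v t x) torusMeasure := hw.add hv
      rw [integral_const_mul, integral_sub hwv (integrable_L2Torus h),
        integral_add hw hv, integral_const_mul] at h1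
      have h2 := hh.meanPart_eq_zero
      simp only [meanPart] at h2 ⊢
      rw [h2, sub_zero] at h1
      exact h1
    have hd1 := hd.comp_clm meanL
    have hd2 := hd.comp_clm homL
    simp only [meanL_apply, homL_apply] at hd1 hd2
    refine ⟨hc, ⟨_, _, hd1, by rw [hu0], by rw [hv0], hmean⟩, _, _, hd2, by rw [hu0],
      by rw [hv0], fun t ht => ?_⟩
    obtain ⟨h, hh, hae⟩ := heq t ht
    refine ⟨h, (isLaplacian_homPart_iff _ _).mpr hh, ?_⟩
    filter_upwards [hae, coeFn_homPart (v t), coeFn_homPart (w t)] with x h1 h2 h3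
    rw [h2, h3]
    linear_combination h1 - hmean t ht

end MeanValue

/-! ### Choice of constants and conclusion -/

theorem mainTheorem1 (κ m R : ℝ) (hκ0 : 0 < κ) (hκ1 : κ < 1) (hm : 5 / 2 < m) (hR : 0 < R) :
    ∃ ε : ℝ, 0 < ε ∧ ∃ η : ℝ → ℝ, Tendsto η (𝓝[≥] 0) (𝓝 0) ∧
      ∀ f g : L2Torus, MemHomSobolev (m + 1) f → MemHomSobolev m g →
        sobolevNorm (m + 1) f ≤ R → sobolevNorm m g ≤ R →
      ∀ a : ℝ → L2Torus, ContSobolev m a →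
      ∀ S : ℝ, IsLUB ((fun t => sobolevNorm m (a t)) '' Ici 0) S → S < ε →
        (∀ u : ℝ → L2Torus, IsProjectedSolution κ m a f g u ↔ IsWaveSolution κ m a f g u) ∧
        ∃ u : ℝ → L2Torus, IsWaveSolution κ m a f g u ∧
          (∀ u' : ℝ → L2Torus, IsWaveSolution κ m a f g u' → EqOn u' u (Ici 0)) ∧
          ∃ L : ℝ, Tendsto (fun t => sobolevNorm (m + 1) (u t)) atTop (𝓝 L) ∧ L ≤ η S := by
  have hm' : 3 / 2 < m := by linarith
  obtain ⟨B, hB⟩ := exists_sobolevMul hm'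
  have hc := gainConst_pos hκ0
  set c := gainConst κ
  set β := ‖B‖ ^ 3
  have hβ : 0 ≤ β := by positivity
  -- The free wave is bounded by `2c(R + 2R) = 6cR`; the extra `1` is room for the Duhamel term.
  set M := 6 * c * R + 1 with hM
  have hM0 : 0 < M := by positivity
  -- This `ε` gives `12cK ≤ κ`, whence `2cK/κ ≤ 1` (the ball is preserved) and `2c · 3K/κ ≤ 1/2`
  -- (contraction). Using `β + 1` avoids division by zero. The function `η` is the bound on the
  -- limit, linear in `sup ‖a‖`.
  refine ⟨κ / (12 * c * (β + 1) * (1 + M) ^ 3), by positivity,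
    fun s => c * (β * s * (1 + M) ^ 3 / κ), ?_, ?_⟩
  · have h : Tendsto (fun s : ℝ => c * (β * s * (1 + M) ^ 3 / κ)) (𝓝 0)
        (𝓝 (c * (β * 0 * (1 + M) ^ 3 / κ))) :=
      Continuous.tendsto (by fun_prop) 0
    simp only [mul_zero, zero_mul, zero_div] at h
    exact h.mono_left nhdsWithin_le_nhds
  intro f g hf hg hfR hgR a ha S hS hSε
  refine ⟨isProjectedSolution_iff κ m a f g, ?_⟩
  have hA : ∀ t, ‖sobolevCoords m (a (max t 0))‖ ≤ S := fun t => by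
    have ht : max t 0 ∈ Ici (0 : ℝ) := le_max_right t 0
    rw [← sobolevNorm_eq (ha.1 _ ht)]
    exact hS.1 (mem_image_of_mem _ ht)
  have hS0 : 0 ≤ S := (norm_nonneg _).trans (hA 0)
  rw [sobolevNorm_eq hf.1] at hfR
  rw [sobolevNorm_eq hg.1] at hgR
  set x₀ := sobolevCoords (m + 1) f with hx₀
  set y₀ := sobolevCoords m g with hy₀
  set A := fun t => sobolevCoords m (a (max t 0)) with hAdef
  set K := β * S * (1 + M) ^ 3 with hK
  have hSmall : 12 * c * K ≤ κ := by
    rw [lt_div_iff₀ (by positivity)] at hSε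
    have : 0 ≤ 12 * c * (1 + M) ^ 3 * S := by positivity
    rw [hK]
    linarith
  have hl : 3 * β * S * (1 + M) ^ 2 ≤ 3 * K := by
    rw [hK]
    have : (1 + M) ^ 2 ≤ (1 + M) ^ 3 := pow_le_pow_right₀ (by linarith) (by norm_num)
    have : β * S * (1 + M) ^ 2 ≤ β * S * (1 + M) ^ 3 := by gcongr
    linarith
  -- Inserting the norm-nonincreasing projection `P` into the fixed point equation forces the
  -- solution to be the coordinates of a real function.
  let P : SeqSpace →L[ℝ] SeqSpace := coeffs.comp synth
  have hP : ∀ x, ‖P x‖ ≤ ‖x‖ := norm_coeffs_synth_le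
  obtain ⟨U, hUc, hUb, hUe⟩ := exists_mild_solution (κ := κ) (c := 2 * c) (K := K)
    (l := 3 * β * S * (1 + M) ^ 2) (M := M) (M₀ := 6 * c * R)
    (S := fun t => P.comp (waveKernel κ t)) (L := fun t => P (freeWave κ x₀ y₀ t))
    (N := fun t x => cubicForce B (A t) x) hκ0 (by positivity) (by positivity) (by positivity)
    (P.continuous.comp (continuous_waveKernel hκ0))
    (fun t x => (hP _).trans (norm_waveKernel_le hκ0 hκ1 t x))
    (P.continuous.comp (continuous_freeWave hκ0 x₀ y₀))
    (fun t _ => (hP _).trans ((norm_freeWave_le hκ0 hκ1 x₀ y₀ t).trans (by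
      calc 2 * c * (‖y₀‖ + 2 * ‖x₀‖) ≤ 2 * c * (R + 2 * R) := by gcongr
        _ = 6 * c * R := by ring)))
    (continuous_cubicForce (continuous_sobolevCoords ha))
    (fun t x hx => norm_cubicForce_le (hA t) hx)
    (fun t x y hx hy => norm_cubicForce_sub_le (hA t) hx hy)
    (by
      have : 2 * c * K / κ ≤ 1 := by
        rw [div_le_one hκ0]
        have : 0 ≤ c * K := by positivity
        linarith
      linarith)
    (by
      rw [div_le_iff₀ hκ0]
      calc 2 * c * (3 * β * S * (1 + M) ^ 2) ≤ 2 * c * (3 * K) := by gcongr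
        _ ≤ 1 / 2 * κ := by linarith)
  have hGc := continuous_waveForce (B := B) (κ := κ) ha hUc
  obtain ⟨u, hu, huU⟩ := isWaveSolution_of_linWave hκ0 hκ1 hm' hB hf.1 hg.1 ha hUc
    fun t ht => by
      rw [hUe t ht, linWave_eq_freeWave_add hκ0 _ _ hGc]
      change _ = P _
      rw [map_add]
      congr 1
      exact P.intervalIntegral_comp_comm
        (((continuous_waveKernel hκ0).comp (f := fun s => (t - s, waveForce B κ m a U s))
          (by fun_prop)).intervalIntegrable _ _)
  refine ⟨u, hu, fun u' hu' => hu.unique hκ0 hκ1 hm' hB hg.1 ha hA hu', ?_⟩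
  have hx00 : x₀ 0 = 0 := by
    rw [hx₀, sobolevCoords_apply hf.1, coeffs_apply, hf.2, mul_zero]
  have hy00 : y₀ 0 = 0 := by
    rw [hy₀, sobolevCoords_apply hg.1, coeffs_apply, hg.2, mul_zero]
  have hUmax : Continuous fun s => sobolevCoords (m + 1) (u (max s 0)) :=
    continuous_sobolevCoords hu.1
  obtain ⟨z, hz, hlim⟩ := exists_tendsto_linWave hκ0 hκ1 hx00 hy00
    (N := fun s => cubicForce B (A s) (sobolevCoords (m + 1) (u (max s 0))))
    ((continuous_cubicForce (continuous_sobolevCoords ha)).comp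
      (f := fun s => (s, sobolevCoords (m + 1) (u (max s 0)))) (by fun_prop))
    (K := K) fun s hs => norm_cubicForce_le (hA s) (by
      rw [max_eq_left hs, huU s hs]
      exact hUb s)
  -- By the Duhamel formula the `H^{m+1}` norm of `u(t)` is the `ℓ²` norm of the convergent curve,
  -- and the bound on `z` is `η S` by definition.
  refine ⟨‖z‖, hlim.norm.congr' ?_, hz⟩
  filter_upwards [eventually_ge_atTop 0] with t ht
  rw [sobolevNorm_eq (hu.1.1 t ht), hu.eq_linWave hκ0 hκ1 hm' hB hg.1 ha ht]
  rfl
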